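/- An inverse monoid is a monoid $S$ in which every $a$ has a unique inverse $a^{-1}$ (with $aa^{-1}a=a$, $a^{-1}aa^{-1}=a^{-1}$). Let $\sigma$ be its least congruence whose quotient is a group, and $\sigma^\sharp\colon S\to S/\sigma$ the projection; $S/\sigma$ is the greatest group image of $S$. $S$ is $E$-unitary if the preimage of $1$ under $\sigma^\sharp$ is the set of idempotents of $S$. A McAlister triple $(G,\mathcal Y,\mathcal X)$ consists of a group $G$ acting by order preserving maps on a poset $\mathcal X$, and an order ideal $\mathcal Y\subseteq\mathcal X$ which is a meet semilattice, such that $G\mathcal Y=\mathcal X$ and $g\mathcal Y\cap\mathcal Y\neq\emptyset$ for all $g\in G$. Its $P$-semigroup $P(G,\mathcal Y,\mathcal X)$ consists of all pairs $(y,g)$ with $g\in G$, $y\in g\mathcal Y\cap\mathcal Y$, with multiplication $(y,g)(z,h)=(y\wedge gz,gh)$, where $y\wedge gz$ is the greatest lower bound in $\mathcal X$ (which exists). Let $G$ be a group generated by a set $X$ via a (not necessarily injective) map $X\to G$. Its Cayley graph $\Gamma_X$ has vertex set $G$ and, for $g\in G$ and each letter $a\in X\cup X^{-1}$, an edge labelled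 $a$ from $g$ to $ga$, whose inverse is the edge labelled $a^{-1}$ from $ga$ to $g$. Subgraphs are closed under endpoints and inverse edges. Let $\operatorname{CSub}\Gamma_X$ be the poset of non-empty connected subgraphs under inclusion, with the left action of $G$. A closure operator $c\colon\Delta\mapsto\Delta^c$ on $\operatorname{CSub}\Gamma_X$ is $G$-invariant if $(g\Delta)^c=g(\Delta^c)$, and finitary if $\Delta^c$ is always the union of the $F^c$ with $F\subseteq\Delta$ finite (and connected). The graphs $F^c$ with $F$ finite are called compact. For $G$-invariant $c$ let $$S_c=\{(\Delta,g): g\in G,\ \Delta\in\operatorname{CSub}\Gamma_X \text{ compact},\ 1,g\in\Delta\},$$ $$(\Delta,g)(\Xi,h)=((\Delta\cup g\Xi)^c,gh),\qquad (\Delta,g)^{-1}=(g^{-1}\Delta,g^{-1}),$$ an inverse monoid with identity $(\{1\}^c,1)$. Let $\mathcal X_c$ be the set of compact graphs ordered by reverse inclusion, with the left action of $G$, and $\mathcal Y_c$ the set of those containing $1$. **Corollary (McAlister's $P$-theorem).** 1. Every $E$-unitary inverse monoid is isomorphic to the $P$-semigroup of some McAlister triple. 2. Let $S$ be an $E$-unitary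 inverse monoid generated by a set $X$ via a map $X\to S$, and let $\Gamma_X$ be the Cayley graph of $G=S/\sigma$, generated by $X$ via the composite map $X\to S\to G$. There is a $G$-invariant, finitary closure operator $c=c_S$ on $\operatorname{CSub}\Gamma_X$ whose closed elements are precisely those $\Delta$ such that, for all words $u,v$ over $X\cup X^{-1}$ with the same value in $S$ and all vertices $g,h$ of $\Delta$, $u$ labels a path from $g$ to $h$ in $\Delta$ if and only if $v$ does. For this $c$, the map $s\mapsto(S\Gamma(s),\sigma^\sharp(s))$ is an isomorphism $S\to S_c$, where $S\Gamma(s)$ is the image in $\Gamma_X$ under $\sigma^\sharp$ of the strong component of $s$ in the Cayley graph of $S$. Moreover $(G,\mathcal Y_c,\mathcal X_c)$ is a McAlister triple, and the same map is an isomorphism $S\to P(G,\mathcal Y_c,\mathcal X_c)$. 3. In general, for every group $G$ generated by a set $X$ via a map and every $G$-invariant, finitary closure operator $c$ on $\operatorname{CSub}\Gamma_X$, the inverse monoid $S_c$ is $E$-unitary, $(G,\mathcal Y_c,\mathcal X_c)$ is a McAlister triple, in which $\Delta\wedge\Xi=(\Delta\cup\Xi)^c$ for $\Delta,\Xi\in\mathcal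 Y_c$, and the identity map on pairs is an isomorphism $S_c\to P(G,\mathcal Y_c,\mathcal X_c)$. -/

import Mathlib

universe u v

/-! ### Inverse monoids and the greatest group image -/

/-- An inverse monoid: every `a` has a unique inverse `a⁻¹`, in the sense that `a * a⁻¹ * a = a`
and `a⁻¹ * a * a⁻¹ = a⁻¹`. -/
class InverseMonoid (S : Type*) extends Monoid S, Inv S where
  mul_inv_mul : ∀ a : S, a * a⁻¹ * a = a
  inv_mul_inv : ∀ a : S, a⁻¹ * a * a⁻¹ = a⁻¹
  eq_inv : ∀ a b : S, a * b * a = a → b * a * b = b → b = a⁻¹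

/-- In an inverse monoid, idempotents commute. -/
theorem InverseMonoid.idem_comm {S : Type*} [InverseMonoid S] {e f : S}
    (he : e * e = e) (hf : f * f = f) : e * f = f * e := by
  have self : ∀ {k : S}, k * k = k → k = k⁻¹ := fun {k} hk =>
    eq_inv k k (by rw [hk, hk]) (by rw [hk, hk])
  have key : ∀ {e f : S}, e * e = e → f * f = f → e * f * (e * f) = e * f := by
    intro e f he hf
    obtain ⟨x, hx⟩ : ∃ x, x = (e * f)⁻¹ := ⟨_, rfl⟩
    have h1 : e * f * x * (e * f) = e * f := hx ▸ mul_inv_mul (e * f)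
    have h2 : x * (e * f) * x = x := hx ▸ inv_mul_inv (e * f)
    have h3 : f * x * e = x := by
      rw [hx]
      rw [hx] at h1 h2
      apply eq_inv
      · calc e * f * (f * (e * f)⁻¹ * e) * (e * f)
            = e * (f * f) * (e * f)⁻¹ * ((e * e) * f) := by simp only [mul_assoc]
          _ = e * f := by rw [he, hf, h1]
      · calc f * (e * f)⁻¹ * e * (e * f) * (f * (e * f)⁻¹ * e)
            = f * ((e * f)⁻¹ * ((e * e) * (f * f)) * (e * f)⁻¹) * e := by simp only [mul_assoc]
          _ = f * (e * f)⁻¹ * e := by rw [he, hf, h2]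
    have h4 : x * x = x := by
      calc x * x = f * x * e * (f * x * e) := by rw [h3]
        _ = f * (x * (e * f) * x) * e := by simp only [mul_assoc]
        _ = x := by rw [h2, h3]
    have h5 : e * f = x := (eq_inv x (e * f) h2 h1).trans (self h4).symm
    rw [h5, h4]
  have hef := key he hf
  have hfe := key hf he
  have h : f * e = (e * f)⁻¹ := by
    apply eq_inv
    · calc e * f * (f * e) * (e * f) = e * (f * f) * ((e * e) * f) := by simp only [mul_assoc]
        _ = e * f := by rw [he, hf, hef]
    · calc f * e * (e * f) * (f * e) = f * (e * e) * ((f * f) * e) := by simp only [mul_assoc]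
        _ = f * e := by rw [he, hf, hfe]
  rw [h]
  exact self hef

/-- The least group congruence `σ`: the least congruence whose quotient is a group. -/
def minGroupCon (S : Type*) [InverseMonoid S] : Con S :=
  sInf {ρ : Con S | ∀ a, ∃ b, ρ (a * b) 1 ∧ ρ (b * a) 1}

theorem minGroupCon_iff {S : Type*} [InverseMonoid S] {a b : S} :
    minGroupCon S a b ↔ ∀ ρ : Con S, (∀ a, ∃ b, ρ (a * b) 1 ∧ ρ (b * a) 1) → ρ a b :=
  Iff.rfl

theorem minGroupCon_idem {S : Type*} [InverseMonoid S] {e : S} (he : e * e = e) :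
    minGroupCon S e 1 := by
  rw [minGroupCon_iff]
  intro ρ hρ
  obtain ⟨b, hb, -⟩ := hρ e
  have h1 : ρ (e * e * b) (e * 1) := by
    rw [mul_assoc]
    exact ρ.mul (ρ.refl e) hb
  rw [he, mul_one] at h1
  exact ρ.trans (ρ.symm h1) hb

theorem minGroupCon_mul_inv {S : Type*} [InverseMonoid S] (a : S) :
    minGroupCon S (a * a⁻¹) 1 :=
  minGroupCon_idem (by rw [← mul_assoc, InverseMonoid.mul_inv_mul])

theorem minGroupCon_inv_mul {S : Type*} [InverseMonoid S] (a : S) :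
    minGroupCon S (a⁻¹ * a) 1 :=
  minGroupCon_idem (by rw [← mul_assoc, InverseMonoid.inv_mul_inv])

theorem minGroupCon_inv {S : Type*} [InverseMonoid S] {a b : S} (h : minGroupCon S a b) :
    minGroupCon S a⁻¹ b⁻¹ := by
  have h1 : minGroupCon S (a⁻¹ * (b * b⁻¹)) (a⁻¹ * 1) :=
    (minGroupCon S).mul ((minGroupCon S).refl _) (minGroupCon_mul_inv b)
  have h2 : minGroupCon S (a⁻¹ * (a * b⁻¹)) (a⁻¹ * (b * b⁻¹)) :=
    (minGroupCon S).mul ((minGroupCon S).refl _) ((minGroupCon S).mul h ((minGroupCon S).refl _))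
  have h3 : minGroupCon S (a⁻¹ * a * b⁻¹) (1 * b⁻¹) :=
    (minGroupCon S).mul (minGroupCon_inv_mul a) ((minGroupCon S).refl _)
  rw [mul_one] at h1
  rw [one_mul, mul_assoc] at h3
  exact (minGroupCon S).trans ((minGroupCon S).symm ((minGroupCon S).trans h2 h1)) h3

/-- The greatest group image `S/σ`. -/
def GroupImage (S : Type*) [InverseMonoid S] : Type _ := (minGroupCon S).Quotient

instance (S : Type*) [InverseMonoid S] : Monoid (GroupImage S) :=
  inferInstanceAs (Monoid (minGroupCon S).Quotient)

/-- The natural projection `σ♯ : S → S/σ`. -/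
def toGroupImage (S : Type*) [InverseMonoid S] : S →* GroupImage S := (minGroupCon S).mk'

instance (S : Type*) [InverseMonoid S] : Group (GroupImage S) where
  inv := Quotient.map' (fun a => a⁻¹) (fun _ _ h => minGroupCon_inv h)
  inv_mul_cancel := by
    intro a
    induction a using Quotient.inductionOn' with
    | h a => exact (minGroupCon S).eq.2 (minGroupCon_inv_mul a)

/-- `S` is `E`-unitary: `σ♯` is idempotent pure, that is, the preimage of `1` under `σ♯` is the set
of idempotents. -/
def IsEUnitary (S : Type*) [InverseMonoid S] : Prop :=
  ∀ s : S, toGroupImage S s = 1 ↔ s * s = s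

/-! ### Generators and words -/

/-- `M` (a group or an inverse monoid) is `X`-generated via `ι`. -/
def IsGeneratedBy {X M : Type*} [Monoid M] [Inv M] (ι : X → M) : Prop :=
  ∀ T : Submonoid M, (∀ x, ι x ∈ T) → (∀ a ∈ T, a⁻¹ ∈ T) → T = ⊤

/-- The value in `M` of a letter in `X ∪ X⁻¹`; the letter `(x, true)` is `x` and `(x, false)` is
the formal inverse `x⁻¹`. -/
def letterVal {X M : Type*} [Inv M] (ι : X → M) (a : X × Bool) : M :=
  cond a.2 (ι a.1) (ι a.1)⁻¹

/-- The value in `M` of a word over `X ∪ X⁻¹`. -/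
def wordVal {X M : Type*} [Monoid M] [Inv M] (ι : X → M) (w : List (X × Bool)) : M :=
  (w.map (letterVal ι)).prod

/-- The formal inverse of a letter. -/
def letterInv {X : Type*} (a : X × Bool) : X × Bool := (a.1, !a.2)

theorem letterInv_letterInv {X : Type*} (a : X × Bool) : letterInv (letterInv a) = a := by
  simp [letterInv]

theorem letterVal_letterInv {X G : Type*} [Group G] (ι : X → G) (a : X × Bool) :
    letterVal ι (letterInv a) = (letterVal ι a)⁻¹ := by
  rcases a with ⟨x, _ | _⟩ <;> simp [letterVal, letterInv]

/-! ### Subgraphs of the Cayley graph of a group -/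

/-- A subgraph of the Cayley graph of the group `G` with respect to `ι : X → G`.  The edge of the
Cayley graph labelled `a ∈ X ∪ X⁻¹` from `g` to `g * a` is written `(g, a)`; its inverse edge is
`(g * a, a⁻¹)`. -/
@[ext]
structure CayleySubgraph {X G : Type*} [Group G] (ι : X → G) where
  verts : Set G
  edges : Set (G × (X × Bool))
  source_mem : ∀ g a, (g, a) ∈ edges → g ∈ verts
  target_mem : ∀ g a, (g, a) ∈ edges → g * letterVal ι a ∈ verts
  inv_mem : ∀ g a, (g, a) ∈ edges → (g * letterVal ι a, letterInv a) ∈ edges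

namespace CayleySubgraph

variable {X G : Type*} [Group G] {ι : X → G}

/-- Inclusion of subgraphs. -/
instance : PartialOrder (CayleySubgraph ι) where
  le Δ Ξ := Δ.verts ⊆ Ξ.verts ∧ Δ.edges ⊆ Ξ.edges
  le_refl _ := ⟨subset_rfl, subset_rfl⟩
  le_trans _ _ _ h k := ⟨h.1.trans k.1, h.2.trans k.2⟩
  le_antisymm _ _ h k := CayleySubgraph.ext (h.1.antisymm k.1) (h.2.antisymm k.2)

/-- Union of subgraphs. -/
def union (Δ Ξ : CayleySubgraph ι) : CayleySubgraph ι where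
  verts := Δ.verts ∪ Ξ.verts
  edges := Δ.edges ∪ Ξ.edges
  source_mem g a h := h.imp (Δ.source_mem g a) (Ξ.source_mem g a)
  target_mem g a h := h.imp (Δ.target_mem g a) (Ξ.target_mem g a)
  inv_mem g a h := h.imp (Δ.inv_mem g a) (Ξ.inv_mem g a)

/-- The left translate `gΔ`: its vertices are the `g * h` with `h` a vertex of `Δ`, and its edges
the `(g * h, a)` with `(h, a)` an edge of `Δ`. -/
def translate (g : G) (Δ : CayleySubgraph ι) : CayleySubgraph ι where
  verts := {h | g⁻¹ * h ∈ Δ.verts}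
  edges := {e | (g⁻¹ * e.1, e.2) ∈ Δ.edges}
  source_mem h a he := Δ.source_mem _ _ he
  target_mem h a he := by
    have := Δ.target_mem _ _ he
    rwa [mul_assoc] at this
  inv_mem h a he := by
    have := Δ.inv_mem _ _ he
    rwa [mul_assoc] at this

/-- `Δ.IsPath g w h`: the path labelled `w` that starts at `g` lies in `Δ` and ends at `h`. -/
def IsPath (Δ : CayleySubgraph ι) : G → List (X × Bool) → G → Prop
  | g, [], h => g ∈ Δ.verts ∧ g = h
  | g, a :: w, h => (g, a) ∈ Δ.edges ∧ Δ.IsPath (g * letterVal ι a) w h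

/-- Connected (in particular non-empty) subgraphs. -/
def IsConnected (Δ : CayleySubgraph ι) : Prop :=
  Δ.verts.Nonempty ∧ ∀ g ∈ Δ.verts, ∀ h ∈ Δ.verts, ∃ w, Δ.IsPath g w h

/-- Finite subgraphs. -/
def IsFinite (Δ : CayleySubgraph ι) : Prop := Δ.verts.Finite ∧ Δ.edges.Finite

theorem IsPath.mono {Δ Ξ : CayleySubgraph ι} (hle : Δ ≤ Ξ) {w : List (X × Bool)} :
    ∀ {g h : G}, Δ.IsPath g w h → Ξ.IsPath g w h := by
  induction w with
  | nil => exact fun hp => ⟨hle.1 hp.1, hp.2⟩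
  | cons a w ih => exact fun hp => ⟨hle.2 hp.1, ih hp.2⟩

theorem IsPath.append {Δ : CayleySubgraph ι} {w w' : List (X × Bool)} :
    ∀ {g h k : G}, Δ.IsPath g w h → Δ.IsPath h w' k → Δ.IsPath g (w ++ w') k := by
  induction w with
  | nil => rintro g h k ⟨-, rfl⟩ hk; exact hk
  | cons a w ih => exact fun hp hk => ⟨hp.1, ih hp.2 hk⟩

theorem IsPath.translate {Δ : CayleySubgraph ι} (x : G) {w : List (X × Bool)} :
    ∀ {g h : G}, Δ.IsPath g w h → (Δ.translate x).IsPath (x * g) w (x * h) := by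
  induction w with
  | nil => rintro g h ⟨hg, rfl⟩; exact ⟨by simpa [CayleySubgraph.translate] using hg, rfl⟩
  | cons a w ih =>
    intro g h hp
    refine ⟨by simpa [CayleySubgraph.translate] using hp.1, ?_⟩
    rw [mul_assoc]
    exact ih hp.2

theorem le_union_left (Δ Ξ : CayleySubgraph ι) : Δ ≤ Δ.union Ξ :=
  ⟨Set.subset_union_left, Set.subset_union_left⟩

theorem le_union_right (Δ Ξ : CayleySubgraph ι) : Ξ ≤ Δ.union Ξ :=
  ⟨Set.subset_union_right, Set.subset_union_right⟩

theorem union_le {Δ Ξ Ω : CayleySubgraph ι} (h : Δ ≤ Ω) (k : Ξ ≤ Ω) : Δ.union Ξ ≤ Ω :=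
  ⟨Set.union_subset h.1 k.1, Set.union_subset h.2 k.2⟩

theorem isConnected_of_vertex {Δ : CayleySubgraph ι} {v : G} (hv : v ∈ Δ.verts)
    (h1 : ∀ g ∈ Δ.verts, ∃ w, Δ.IsPath g w v) (h2 : ∀ g ∈ Δ.verts, ∃ w, Δ.IsPath v w g) :
    Δ.IsConnected := by
  refine ⟨⟨v, hv⟩, fun g hg h hh => ?_⟩
  obtain ⟨w, hw⟩ := h1 g hg
  obtain ⟨w', hw'⟩ := h2 h hh
  exact ⟨_, hw.append hw'⟩

theorem IsConnected.union {Δ Ξ : CayleySubgraph ι} (hΔ : Δ.IsConnected) (hΞ : Ξ.IsConnected)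
    {v : G} (h1 : v ∈ Δ.verts) (h2 : v ∈ Ξ.verts) : (Δ.union Ξ).IsConnected := by
  refine isConnected_of_vertex (v := v) (Or.inl h1) ?_ ?_
  · rintro g (hg | hg)
    · exact (hΔ.2 g hg v h1).imp fun _ => IsPath.mono (le_union_left Δ Ξ)
    · exact (hΞ.2 g hg v h2).imp fun _ => IsPath.mono (le_union_right Δ Ξ)
  · rintro g (hg | hg)
    · exact (hΔ.2 v h1 g hg).imp fun _ => IsPath.mono (le_union_left Δ Ξ)
    · exact (hΞ.2 v h2 g hg).imp fun _ => IsPath.mono (le_union_right Δ Ξ)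

theorem IsConnected.translate {Δ : CayleySubgraph ι} (hΔ : Δ.IsConnected) (x : G) :
    (Δ.translate x).IsConnected := by
  obtain ⟨v, hv⟩ := hΔ.1
  refine ⟨⟨x * v, by simpa [CayleySubgraph.translate] using hv⟩, fun g hg h hh => ?_⟩
  obtain ⟨w, hw⟩ := hΔ.2 _ hg _ hh
  exact ⟨w, by simpa using hw.translate x⟩

theorem IsFinite.union {Δ Ξ : CayleySubgraph ι} (hΔ : Δ.IsFinite) (hΞ : Ξ.IsFinite) :
    (Δ.union Ξ).IsFinite := ⟨hΔ.1.union hΞ.1, hΔ.2.union hΞ.2⟩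

theorem IsFinite.translate {Δ : CayleySubgraph ι} (hΔ : Δ.IsFinite) (x : G) :
    (Δ.translate x).IsFinite := by
  refine ⟨hΔ.1.preimage (mul_right_injective x⁻¹).injOn, hΔ.2.preimage (Function.Injective.injOn ?_)⟩
  rintro ⟨g, a⟩ ⟨h, b⟩ hgh
  simpa using hgh

/-- The subgraph consisting of the edge `(g, a)`, its inverse and its endpoints. -/
def edgeGraph (ι : X → G) (g : G) (a : X × Bool) : CayleySubgraph ι where
  verts := {g, g * letterVal ι a}
  edges := {(g, a), (g * letterVal ι a, letterInv a)}
  source_mem := by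
    rintro h b (hb | hb) <;> simp only [Set.mem_singleton_iff, Prod.mk.injEq] at hb <;>
      obtain ⟨rfl, rfl⟩ := hb <;> simp
  target_mem := by
    rintro h b (hb | hb) <;> simp only [Set.mem_singleton_iff, Prod.mk.injEq] at hb <;>
      obtain ⟨rfl, rfl⟩ := hb <;> simp [letterVal_letterInv]
  inv_mem := by
    rintro h b (hb | hb) <;> simp only [Set.mem_singleton_iff, Prod.mk.injEq] at hb <;>
      obtain ⟨rfl, rfl⟩ := hb <;> simp [letterVal_letterInv, letterInv_letterInv]

theorem edgeGraph_isFinite (g : G) (a : X × Bool) : (edgeGraph ι g a).IsFinite :=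
  ⟨Set.toFinite {g, g * letterVal ι a}, Set.toFinite {(g, a), (g * letterVal ι a, letterInv a)}⟩

theorem edgeGraph_isConnected (g : G) (a : X × Bool) : (edgeGraph ι g a).IsConnected := by
  have hg : g ∈ (edgeGraph ι g a).verts := Or.inl rfl
  have hga : g * letterVal ι a ∈ (edgeGraph ι g a).verts := Or.inr rfl
  refine isConnected_of_vertex hg ?_ ?_
  · rintro h (rfl | rfl)
    · exact ⟨[], hg, rfl⟩
    · exact ⟨[letterInv a], Or.inr rfl, by simpa [letterVal_letterInv] using hg,
        by simp [letterVal_letterInv]⟩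
  · rintro h (rfl | rfl)
    · exact ⟨[], hg, rfl⟩
    · exact ⟨[a], Or.inl rfl, hga, rfl⟩

theorem edgeGraph_le {Δ : CayleySubgraph ι} {g : G} {a : X × Bool} (h : (g, a) ∈ Δ.edges) :
    edgeGraph ι g a ≤ Δ := by
  constructor
  · rintro k (rfl | rfl)
    exacts [Δ.source_mem _ _ h, Δ.target_mem _ _ h]
  · rintro k (rfl | rfl)
    exacts [h, Δ.inv_mem _ _ h]

theorem exists_finite_of_path {Δ : CayleySubgraph ι} {w : List (X × Bool)} :
    ∀ {g h : G} (F : CayleySubgraph ι), F.IsFinite → F.IsConnected → F ≤ Δ → g ∈ F.verts →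
      Δ.IsPath g w h →
      ∃ F' : CayleySubgraph ι, F'.IsFinite ∧ F'.IsConnected ∧ F ≤ F' ∧ F' ≤ Δ ∧ h ∈ F'.verts := by
  induction w with
  | nil => rintro g h F h1 h2 h3 h4 ⟨-, rfl⟩; exact ⟨F, h1, h2, le_rfl, h3, h4⟩
  | cons a w ih =>
    intro g h F h1 h2 h3 h4 hp
    obtain ⟨F', k1, k2, k3, k4, k5⟩ := ih (F.union (edgeGraph ι g a))
      (h1.union (edgeGraph_isFinite g a)) (h2.union (edgeGraph_isConnected g a) h4 (Or.inl rfl))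
      (union_le h3 (edgeGraph_le hp.1)) (Or.inr (Or.inr rfl)) hp.2
    exact ⟨F', k1, k2, (le_union_left _ _).trans k3, k4, k5⟩

end CayleySubgraph

/-- `CSub Γ_X`: the connected subgraphs of the Cayley graph, ordered by inclusion. -/
abbrev CSub {X G : Type*} [Group G] (ι : X → G) : Type _ :=
  {Δ : CayleySubgraph ι // Δ.IsConnected}

namespace CSub

variable {X G : Type*} [Group G] {ι : X → G}

/-- The left action of `G` on `CSub Γ_X`. -/
instance : MulAction G (CSub ι) where
  smul g Δ := ⟨Δ.1.translate g, Δ.2.translate g⟩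
  one_smul Δ := by
    apply Subtype.ext
    change Δ.1.translate 1 = Δ.1
    simp [CayleySubgraph.translate]
  mul_smul g h Δ := by
    apply Subtype.ext
    change Δ.1.translate (g * h) = (Δ.1.translate h).translate g
    simp [CayleySubgraph.translate, mul_assoc]

/-- The union of two connected subgraphs with a common vertex `v`. -/
def union (Δ Ξ : CSub ι) (v : G) (h1 : v ∈ Δ.1.verts) (h2 : v ∈ Ξ.1.verts) : CSub ι :=
  ⟨Δ.1.union Ξ.1, Δ.2.union Ξ.2 h1 h2⟩

theorem mem_smul {g h : G} {Δ : CSub ι} : h ∈ (g • Δ).1.verts ↔ g⁻¹ * h ∈ Δ.1.verts := Iff.rfl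

theorem smul_le {g : G} {Δ Ξ : CSub ι} (h : Δ ≤ Ξ) : g • Δ ≤ g • Ξ :=
  ⟨fun _ hk => h.1 hk, fun _ hk => h.2 hk⟩

theorem smul_le_iff {g : G} {Δ Ξ : CSub ι} : g • Δ ≤ Ξ ↔ Δ ≤ g⁻¹ • Ξ :=
  ⟨fun h => by simpa using smul_le (g := g⁻¹) h, fun h => by simpa using smul_le (g := g) h⟩

theorem left_le (Δ Ξ : CSub ι) (v : G) (h1 : v ∈ Δ.1.verts) (h2 : v ∈ Ξ.1.verts) :
    Δ ≤ Δ.union Ξ v h1 h2 := CayleySubgraph.le_union_left _ _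

theorem right_le (Δ Ξ : CSub ι) (v : G) (h1 : v ∈ Δ.1.verts) (h2 : v ∈ Ξ.1.verts) :
    Ξ ≤ Δ.union Ξ v h1 h2 := CayleySubgraph.le_union_right _ _

theorem union_le {Δ Ξ Ω : CSub ι} {v : G} {h1 : v ∈ Δ.1.verts} {h2 : v ∈ Ξ.1.verts}
    (h : Δ ≤ Ω) (k : Ξ ≤ Ω) : Δ.union Ξ v h1 h2 ≤ Ω := CayleySubgraph.union_le h k

/-- The subgraph with the single vertex `1` and no edges. -/
def single (ι : X → G) : CSub ι :=
  ⟨⟨{1}, ∅, by simp, by simp, by simp⟩, ⟨1, rfl⟩, by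
    rintro g rfl h rfl
    exact ⟨[], rfl, rfl⟩⟩

theorem single_le {Δ : CSub ι} (h : 1 ∈ Δ.1.verts) : single ι ≤ Δ :=
  ⟨fun k hk => by obtain rfl : k = 1 := hk; exact h, fun _ hk => hk.elim⟩

end CSub

/-! ### Closure operators on `CSub Γ_X` -/

section Closure

variable {X G : Type*} [Group G] {ι : X → G}

/-- `G`-invariant closure operators. -/
def GInvariant (c : ClosureOperator (CSub ι)) : Prop :=
  ∀ (g : G) (Δ : CSub ι), c (g • Δ) = g • c Δ

/-- Finitary closure operators: `Δᶜ` is the union of all `Fᶜ` with `F ⊆ Δ` finite. -/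
def IsFinitary (c : ClosureOperator (CSub ι)) : Prop :=
  ∀ Δ : CSub ι,
    (c Δ).1.verts = ⋃ F ∈ {F : CSub ι | F.1.IsFinite ∧ F ≤ Δ}, (c F).1.verts ∧
    (c Δ).1.edges = ⋃ F ∈ {F : CSub ι | F.1.IsFinite ∧ F ≤ Δ}, (c F).1.edges

/-- Compact subgraphs: the closures of finite connected subgraphs. -/
def IsCompactGraph (c : ClosureOperator (CSub ι)) (Δ : CSub ι) : Prop :=
  ∃ F : CSub ι, F.1.IsFinite ∧ c F = Δ

variable {c : ClosureOperator (CSub ι)}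

theorem IsCompactGraph.closed {Δ : CSub ι} (h : IsCompactGraph c Δ) : c Δ = Δ := by
  obtain ⟨F, -, rfl⟩ := h
  exact c.idempotent F

theorem IsCompactGraph.closure_le {Δ Ξ : CSub ι} (h : IsCompactGraph c Δ) (hle : Ξ ≤ Δ) :
    c Ξ ≤ Δ := by
  have := c.monotone hle
  rwa [h.closed] at this

theorem IsCompactGraph.exists_finite {Δ : CSub ι} (h : IsCompactGraph c Δ) {v : G}
    (hv : v ∈ Δ.1.verts) : ∃ F : CSub ι, F.1.IsFinite ∧ v ∈ F.1.verts ∧ c F = Δ := by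
  obtain ⟨F, hF, rfl⟩ := id h
  obtain ⟨g, hg⟩ := F.2.1
  obtain ⟨w, hw⟩ := (c F).2.2 g ((c.le_closure F).1 hg) v hv
  obtain ⟨F', k1, k2, k3, k4, k5⟩ :=
    CayleySubgraph.exists_finite_of_path F.1 hF F.2 (c.le_closure F) hg hw
  exact ⟨⟨F', k2⟩, k1, k5, le_antisymm (h.closure_le k4) (c.monotone k3)⟩

theorem IsCompactGraph.smul (hc : GInvariant c) {Δ : CSub ι} (h : IsCompactGraph c Δ) (g : G) :
    IsCompactGraph c (g • Δ) := by
  obtain ⟨F, hF, rfl⟩ := h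
  exact ⟨g • F, hF.translate g, hc g F⟩

theorem IsCompactGraph.union {Δ Ξ : CSub ι} (hΔ : IsCompactGraph c Δ) (hΞ : IsCompactGraph c Ξ)
    {v : G} (h1 : v ∈ Δ.1.verts) (h2 : v ∈ Ξ.1.verts) :
    IsCompactGraph c (c (Δ.union Ξ v h1 h2)) := by
  obtain ⟨F, hF, hvF, rfl⟩ := hΔ.exists_finite h1
  obtain ⟨K, hK, hvK, rfl⟩ := hΞ.exists_finite h2
  refine ⟨F.union K v hvF hvK, hF.union hK, le_antisymm (c.monotone ?_) ?_⟩
  · exact CSub.union_le ((c.le_closure F).trans (CSub.left_le _ _ _ _ _))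
      ((c.le_closure K).trans (CSub.right_le _ _ _ _ _))
  · refine IsCompactGraph.closure_le ⟨F.union K v hvF hvK, hF.union hK, rfl⟩ ?_
    exact CSub.union_le (c.monotone (CSub.left_le _ _ _ _ _))
      (c.monotone (CSub.right_le _ _ _ _ _))

end Closure

/-! ### The inverse monoid `S_c` -/

section Sc

variable {X G : Type*} [Group G] {ι : X → G}

/-- `S_c`: the pairs `(Δ, g)` where `Δ` is a compact connected subgraph containing `1` and `g`. -/
@[ext]
structure ClosureMonoid (c : ClosureOperator (CSub ι)) (hc : GInvariant c) where
  graph : CSub ι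
  elt : G
  compact : IsCompactGraph c graph
  one_mem : 1 ∈ graph.1.verts
  elt_mem : elt ∈ graph.1.verts

namespace ClosureMonoid

variable {c : ClosureOperator (CSub ι)} {hc : GInvariant c}

theorem mem_smul_graph (p q : ClosureMonoid c hc) : p.elt ∈ (p.elt • q.graph).1.verts := by
  simpa [CSub.mem_smul] using q.one_mem

/-- `(Δ, g)(Ξ, h) = ((Δ ∪ gΞ)ᶜ, gh)`. -/
instance : Mul (ClosureMonoid c hc) where
  mul p q :=
    { graph := c (p.graph.union (p.elt • q.graph) p.elt p.elt_mem (mem_smul_graph p q))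
      elt := p.elt * q.elt
      compact := p.compact.union (q.compact.smul hc _) _ _
      one_mem := (c.le_closure _).1 (Or.inl p.one_mem)
      elt_mem := (c.le_closure _).1 (Or.inr (by
        change p.elt⁻¹ * (p.elt * q.elt) ∈ q.graph.1.verts
        simpa using q.elt_mem)) }

/-- The identity element `({1}ᶜ, 1)`. -/
instance : One (ClosureMonoid c hc) where
  one :=
    { graph := c (CSub.single ι)
      elt := 1
      compact := ⟨CSub.single ι, ⟨Set.finite_singleton 1, Set.finite_empty⟩, rfl⟩
      one_mem := (c.le_closure _).1 rfl
      elt_mem := (c.le_closure _).1 rfl }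

/-- `(Δ, g)⁻¹ = (g⁻¹Δ, g⁻¹)`. -/
instance : Inv (ClosureMonoid c hc) where
  inv p :=
    { graph := p.elt⁻¹ • p.graph
      elt := p.elt⁻¹
      compact := p.compact.smul hc _
      one_mem := by simpa [CSub.mem_smul] using p.elt_mem
      elt_mem := by simpa [CSub.mem_smul] using p.one_mem }

theorem mul_elt (p q : ClosureMonoid c hc) : (p * q).elt = p.elt * q.elt := rfl
theorem one_elt : (1 : ClosureMonoid c hc).elt = 1 := rfl
theorem inv_elt (p : ClosureMonoid c hc) : p⁻¹.elt = p.elt⁻¹ := rfl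
theorem inv_graph (p : ClosureMonoid c hc) : p⁻¹.graph = p.elt⁻¹ • p.graph := rfl

theorem le_mul_left (p q : ClosureMonoid c hc) : p.graph ≤ (p * q).graph :=
  (CSub.left_le _ _ _ _ _).trans (c.le_closure _)

theorem le_mul_right (p q : ClosureMonoid c hc) : p.elt • q.graph ≤ (p * q).graph :=
  (CSub.right_le _ _ _ _ _).trans (c.le_closure _)

theorem mul_le {p q : ClosureMonoid c hc} {Ω : CSub ι} (hΩ : IsCompactGraph c Ω)
    (h : p.graph ≤ Ω) (k : p.elt • q.graph ≤ Ω) : (p * q).graph ≤ Ω :=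
  hΩ.closure_le (CSub.union_le h k)

theorem mul_le_iff {p q : ClosureMonoid c hc} {Ω : CSub ι} (hΩ : IsCompactGraph c Ω) :
    (p * q).graph ≤ Ω ↔ p.graph ≤ Ω ∧ p.elt • q.graph ≤ Ω :=
  ⟨fun h => ⟨(le_mul_left p q).trans h, (le_mul_right p q).trans h⟩, fun h => mul_le hΩ h.1 h.2⟩

theorem eq_of {p q : ClosureMonoid c hc} (h : p.elt = q.elt)
    (k : ∀ Ω, IsCompactGraph c Ω → (p.graph ≤ Ω ↔ q.graph ≤ Ω)) : p = q :=
  ClosureMonoid.ext (le_antisymm ((k _ q.compact).2 le_rfl) ((k _ p.compact).1 le_rfl)) h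

theorem graph_le_of_eq {p q : ClosureMonoid c hc} (h : p = q) : p.graph ≤ q.graph := h ▸ le_rfl

instance : InverseMonoid (ClosureMonoid c hc) where
  mul_assoc p q r := by
    refine eq_of (mul_assoc _ _ _) fun Ω hΩ => ?_
    rw [mul_le_iff hΩ, mul_le_iff hΩ, mul_le_iff hΩ, CSub.smul_le_iff (Δ := (q * r).graph),
      mul_le_iff (hΩ.smul hc _), ← CSub.smul_le_iff, ← CSub.smul_le_iff, mul_elt, mul_smul,
      and_assoc]
  one_mul p := by
    refine eq_of (one_mul _) fun Ω hΩ => ?_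
    rw [mul_le_iff hΩ, one_elt, one_smul]
    exact ⟨fun h => h.2, fun h => ⟨hΩ.closure_le (CSub.single_le (h.1 p.one_mem)), h⟩⟩
  mul_one p := by
    refine eq_of (mul_one _) fun Ω hΩ => ?_
    rw [mul_le_iff hΩ]
    refine ⟨fun h => h.1, fun h => ⟨h, ?_⟩⟩
    rw [CSub.smul_le_iff]
    refine (hΩ.smul hc _).closure_le (CSub.single_le ?_)
    simpa [CSub.mem_smul] using h.1 p.elt_mem
  mul_inv_mul p := by
    refine eq_of (by simp [mul_elt, inv_elt]) fun Ω hΩ => ?_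
    rw [mul_le_iff hΩ, mul_le_iff hΩ, inv_graph, mul_elt, inv_elt]
    simp
  inv_mul_inv p := by
    refine eq_of (by simp [mul_elt, inv_elt]) fun Ω hΩ => ?_
    rw [mul_le_iff hΩ, mul_le_iff hΩ, inv_graph, mul_elt, inv_elt]
    simp
  eq_inv p q h1 h2 := by
    have he : q.elt = p.elt⁻¹ := by
      have := congrArg ClosureMonoid.elt h1
      rw [mul_elt, mul_elt] at this
      exact eq_inv_of_mul_eq_one_right (mul_eq_right.1 this)
    refine ClosureMonoid.ext (le_antisymm ?_ ?_) he
    · rw [inv_graph, ← CSub.smul_le_iff]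
      exact (le_mul_right p q).trans ((le_mul_left _ _).trans (graph_le_of_eq h1))
    · rw [inv_graph, ← he]
      exact (le_mul_right q p).trans ((le_mul_left _ _).trans (graph_le_of_eq h2))

end ClosureMonoid

end Sc

/-! ### McAlister triples and `P`-semigroups -/

/-- `(G, 𝒴, 𝒳)` is a McAlister triple: `G` acts on the poset `𝒳` by order preserving maps, `𝒴` is an
order ideal of `𝒳` and a meet semilattice, `G𝒴 = 𝒳`, and `g𝒴` meets `𝒴` for every `g`. -/
structure IsMcAlisterTriple (G : Type*) {𝒳 : Type*} [Group G] [PartialOrder 𝒳] [MulAction G 𝒳]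
    (𝒴 : Set 𝒳) : Prop where
  smul_le_smul : ∀ (g : G) (x y : 𝒳), x ≤ y → g • x ≤ g • y
  isLowerSet : IsLowerSet 𝒴
  exists_meet : ∀ y z : 𝒴, ∃ m : 𝒴, IsGLB {y, z} m
  exists_smul_eq : ∀ x : 𝒳, ∃ (g : G), ∃ y ∈ 𝒴, g • y = x
  exists_smul_mem : ∀ g : G, ∃ y ∈ 𝒴, g • y ∈ 𝒴

/-- The `P`-semigroup `P(G, 𝒴, 𝒳)`: the pairs `(y, g)` with `y ∈ g𝒴 ∩ 𝒴`. -/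
@[ext]
structure PSemigroup {G 𝒳 : Type*} [Group G] [PartialOrder 𝒳] [MulAction G 𝒳] {𝒴 : Set 𝒳}
    (hT : IsMcAlisterTriple G 𝒴) where
  fst : 𝒳
  snd : G
  mem : fst ∈ ((fun y => snd • y) '' 𝒴) ∩ 𝒴

section PSemigroup

variable {G 𝒳 : Type*} [Group G] [PartialOrder 𝒳] [MulAction G 𝒳] {𝒴 : Set 𝒳}

theorem IsMcAlisterTriple.exists_isGLB (hT : IsMcAlisterTriple G 𝒴) (p q : PSemigroup hT) :
    ∃ m, IsGLB {p.fst, p.snd • q.fst} m := by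
  obtain ⟨⟨y, hy, hpy⟩, -⟩ := p.mem
  simp only at hpy
  obtain ⟨⟨m, hm⟩, hlb, hgr⟩ := hT.exists_meet ⟨y, hy⟩ ⟨q.fst, q.mem.2⟩
  have h1 : m ≤ y := hlb (Set.mem_insert _ _)
  have h2 : m ≤ q.fst := hlb (Set.mem_insert_of_mem _ rfl)
  refine ⟨p.snd • m, ?_, fun x hx => ?_⟩
  · rintro x (rfl | rfl)
    · rw [← hpy]; exact hT.smul_le_smul _ _ _ h1
    · exact hT.smul_le_smul _ _ _ h2
  · have k1 : p.snd⁻¹ • x ≤ y := by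
      have := hT.smul_le_smul p.snd⁻¹ _ _ (hx (Set.mem_insert _ _))
      rwa [← hpy, inv_smul_smul] at this
    have k2 : p.snd⁻¹ • x ≤ q.fst := by
      have := hT.smul_le_smul p.snd⁻¹ _ _ (hx (Set.mem_insert_of_mem _ rfl))
      rwa [inv_smul_smul] at this
    have k3 : (⟨p.snd⁻¹ • x, hT.isLowerSet k1 hy⟩ : 𝒴) ≤ ⟨m, hm⟩ := by
      apply hgr
      rintro z (rfl | rfl)
      exacts [k1, k2]
    have := hT.smul_le_smul p.snd _ _ (Subtype.coe_le_coe.2 k3)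
    rwa [smul_inv_smul] at this

/-- `(y, g)(z, h) = (y ∧ gz, gh)`, where `y ∧ gz` is the greatest lower bound in `𝒳`. -/
noncomputable instance (hT : IsMcAlisterTriple G 𝒴) : Mul (PSemigroup hT) where
  mul p q :=
    { fst := (hT.exists_isGLB p q).choose
      snd := p.snd * q.snd
      mem := by
        have hm := (hT.exists_isGLB p q).choose_spec
        have h1 := hm.1 (Set.mem_insert _ _)
        have h2 := hm.1 (Set.mem_insert_of_mem _ rfl)
        refine ⟨⟨(p.snd * q.snd)⁻¹ • (hT.exists_isGLB p q).choose, ?_, smul_inv_smul _ _⟩,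
          hT.isLowerSet h1 p.mem.2⟩
        obtain ⟨⟨z, hz, hqz⟩, -⟩ := q.mem
        have h3 := hT.smul_le_smul (p.snd * q.snd)⁻¹ _ _ h2
        have h4 : (p.snd * q.snd)⁻¹ • p.snd • q.fst = z := by
          rw [← hqz, mul_inv_rev, mul_smul, inv_smul_smul, inv_smul_smul]
        exact hT.isLowerSet (h3.trans_eq h4) hz }

end PSemigroup

/-! ### The triple of a closure operator -/

section Triple

variable {X G : Type*} [Group G] {ι : X → G}

/-- The poset `𝒳` of compact subgraphs, ordered by reverse inclusion. -/
@[ext]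
structure CompactGraphs (c : ClosureOperator (CSub ι)) (hc : GInvariant c) where
  graph : CSub ι
  compact : IsCompactGraph c graph

variable {c : ClosureOperator (CSub ι)} {hc : GInvariant c}

instance : PartialOrder (CompactGraphs c hc) where
  le Δ Ξ := Ξ.graph ≤ Δ.graph
  le_refl _ := le_refl _
  le_trans _ _ _ h k := le_trans k h
  le_antisymm _ _ h k := CompactGraphs.ext (le_antisymm k h)

instance : MulAction G (CompactGraphs c hc) where
  smul g Δ := ⟨g • Δ.graph, Δ.compact.smul hc g⟩
  one_smul Δ := CompactGraphs.ext (one_smul G Δ.graph)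
  mul_smul g h Δ := CompactGraphs.ext (mul_smul g h Δ.graph)

/-- The set `𝒴` of compact subgraphs containing `1`. -/
def compactGraphsOne (c : ClosureOperator (CSub ι)) (hc : GInvariant c) :
    Set (CompactGraphs c hc) :=
  {Δ | 1 ∈ Δ.graph.1.verts}

end Triple

/-! ### The closure operator and the Schützenberger graphs of an inverse monoid -/

section Schutzenberger

variable {X S : Type*} [InverseMonoid S]

/-- The generating map `σ♯ ∘ ι` of the greatest group image. -/
def groupGen (ι : X → S) : X → GroupImage S := fun x => toGroupImage S (ι x)

/-- The closed graphs that determine the closure operator `c_S`: whenever the words `u` and `v` have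
the same value in `S`, then `u` labels a path in `Δ` between given vertices if and only if `v`
does. -/
def IsClosedGraph (ι : X → S) (Δ : CSub (groupGen ι)) : Prop :=
  ∀ u v : List (X × Bool), wordVal ι u = wordVal ι v →
    ∀ g ∈ Δ.1.verts, ∀ h ∈ Δ.1.verts, Δ.1.IsPath g u h ↔ Δ.1.IsPath g v h

/-- `s` and `t` lie in the same strong component of the Cayley graph of `S`. -/
def SameComponent (ι : X → S) (s t : S) : Prop :=
  (∃ w, s * wordVal ι w = t) ∧ ∃ w, t * wordVal ι w = s

theorem toGroupImage_inv (s : S) : toGroupImage S s⁻¹ = (toGroupImage S s)⁻¹ := rfl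

theorem toGroupImage_letterVal (ι : X → S) (a : X × Bool) :
    toGroupImage S (letterVal ι a) = letterVal (groupGen ι) a := by
  rcases a with ⟨x, _ | _⟩ <;> rfl

theorem inverseMonoid_inv_inv (a : S) : a⁻¹⁻¹ = a :=
  (InverseMonoid.eq_inv a⁻¹ a (InverseMonoid.inv_mul_inv a) (InverseMonoid.mul_inv_mul a)).symm

theorem letterVal_letterInv' (ι : X → S) (a : X × Bool) :
    letterVal ι (letterInv a) = (letterVal ι a)⁻¹ := by
  rcases a with ⟨x, _ | _⟩ <;> simp [letterVal, letterInv, inverseMonoid_inv_inv]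

theorem mul_mul_inv_cancel_of {t a v : S} (h : t * a * v = t) : t * a * a⁻¹ = t := by
  obtain ⟨e, he⟩ : ∃ e, e = t⁻¹ * t := ⟨_, rfl⟩
  have hte : t * e = t := by rw [he, ← mul_assoc, InverseMonoid.mul_inv_mul]
  have hee : e * e = e := by
    rw [he, ← mul_assoc, InverseMonoid.inv_mul_inv]
  have haa : a * a⁻¹ * (a * a⁻¹) = a * a⁻¹ := by
    rw [← mul_assoc, InverseMonoid.mul_inv_mul]
  have heav : e * a * v = e := by
    rw [he, mul_assoc, mul_assoc, ← mul_assoc t, h]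
  have hcomm := InverseMonoid.idem_comm hee haa
  have h1 : a * a⁻¹ * e = e := by
    calc a * a⁻¹ * e = a * a⁻¹ * (e * a * v) := by rw [heav]
      _ = (a * a⁻¹ * e) * a * v := by simp only [mul_assoc]
      _ = e * (a * a⁻¹ * a) * v := by rw [← hcomm]; simp only [mul_assoc]
      _ = e := by rw [InverseMonoid.mul_inv_mul, heav]
  calc t * a * a⁻¹ = t * (e * (a * a⁻¹)) := by
        rw [← mul_assoc t e, hte, mul_assoc]
    _ = t := by rw [hcomm, h1, hte]

/-- The image in the Cayley graph of the greatest group image of the Schützenberger graph `SΓ(s)`,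
the strong component of `s` in the Cayley graph of `S`, under the map induced by `σ♯`. -/
def schutzenbergerGraph (ι : X → S) (s : S) : CayleySubgraph (groupGen ι) where
  verts := {g | ∃ t, SameComponent ι s t ∧ toGroupImage S t = g}
  edges := {e | ∃ t, SameComponent ι s t ∧ SameComponent ι s (t * letterVal ι e.2) ∧
    toGroupImage S t = e.1}
  source_mem := by
    rintro g a ⟨t, ht, -, rfl⟩
    exact ⟨t, ht, rfl⟩
  target_mem := by
    rintro g a ⟨t, -, ht, rfl⟩
    exact ⟨_, ht, by rw [map_mul, toGroupImage_letterVal]⟩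
  inv_mem := by
    rintro g a ⟨t, ht, ht', rfl⟩
    refine ⟨_, ht', ?_, by rw [map_mul, toGroupImage_letterVal]⟩
    obtain ⟨w, hw⟩ := ht'.2
    obtain ⟨w', hw'⟩ := ht.1
    have : t * letterVal ι a * (wordVal ι w * wordVal ι w') = t := by
      rw [← mul_assoc, hw, hw']
    simp only
    rw [letterVal_letterInv', mul_mul_inv_cancel_of this]
    exact ht

end Schutzenberger

/-! ### Calculus in inverse monoids -/

namespace InverseMonoid

variable {S : Type*} [InverseMonoid S]

/-! Call `x * x⁻¹` the range of `x`, and order idempotents by `e ≤ f` iff `e * f = e`. Everything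
about `S` rests on one consequence of `E`-unitarity: an element is determined by its range and its
image in `S/σ` (`IsEUnitary.eq_of_range_eq`).

A set `A` of idempotents and a vertex `v` give a graph `idemGraph`. A word with value `s` should be
readable from `k` exactly when some `t` leads from `v` to `k` in `S/σ` and some `e ∈ A` lies below
the range of `t * s`; this relation is `Reaches`. If `A` is closed under products, then by
`E`-unitarity different witnesses `t` over the same `k` agree below a common element of `A`. So the
one-letter conditions compose along words (`Reaches.mul`), readability depends only on the value in
`S`, and the graph is closed. Conversely, let a closed graph read a loop `p` of value `e` at `v`,
and let `e` lie below the range of `x`, the value of a word `q`. Then `p` and `p q q⁻¹` have the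
same value, so the graph also reads `q` from `v`. Hence the closure of `Δ` is the graph of the
idempotent values of its loops at any vertex. Each of its vertices and edges is forced by a single
loop, so the operator is finitary.

The Schützenberger graph of `s` is the graph of `{s * s⁻¹}` at `1`. It is the least closed graph in
which a word for `s` is readable from `1` (`schutzenbergerCSub_le_iff`); compactness and
multiplicativity follow. The graph recovers the range of `s`, which gives injectivity, and a loop
traversing a finite generating subgraph gives surjectivity.

For an arbitrary `c`, meets under reverse inclusion are closures of unions, so the products of `S_c`
and of the `P`-semigroup agree. Taking `S` as its own generating set yields the `P`-theorem. -/

theorem mul_inv_idem (a : S) : a * a⁻¹ * (a * a⁻¹) = a * a⁻¹ := by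
  rw [← mul_assoc, mul_inv_mul]

theorem inv_mul_idem (a : S) : a⁻¹ * a * (a⁻¹ * a) = a⁻¹ * a := by
  rw [← mul_assoc, inv_mul_inv]

theorem idem_inv {e : S} (he : e * e = e) : e⁻¹ = e :=
  (eq_inv e e (by rw [he, he]) (by rw [he, he])).symm

theorem one_inv : (1 : S)⁻¹ = 1 := idem_inv (mul_one 1)

protected theorem mul_inv_rev (a b : S) : (a * b)⁻¹ = b⁻¹ * a⁻¹ := by
  have hc := idem_comm (mul_inv_idem b) (inv_mul_idem a)
  refine (eq_inv _ _ ?_ ?_).symm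
  · calc a * b * (b⁻¹ * a⁻¹) * (a * b) = a * ((b * b⁻¹) * (a⁻¹ * a)) * b := by
          simp only [mul_assoc]
      _ = (a * a⁻¹ * a) * (b * b⁻¹ * b) := by rw [hc]; simp only [mul_assoc]
      _ = a * b := by rw [mul_inv_mul, mul_inv_mul]
  · calc b⁻¹ * a⁻¹ * (a * b) * (b⁻¹ * a⁻¹) = b⁻¹ * ((a⁻¹ * a) * (b * b⁻¹)) * a⁻¹ := by
          simp only [mul_assoc]
      _ = (b⁻¹ * b * b⁻¹) * (a⁻¹ * a * a⁻¹) := by rw [← hc]; simp only [mul_assoc]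
      _ = b⁻¹ * a⁻¹ := by rw [inv_mul_inv, inv_mul_inv]

theorem mul_mul_mul_inv (x y : S) : x * x⁻¹ * (x * y * (x * y)⁻¹) = x * y * (x * y)⁻¹ := by
  calc x * x⁻¹ * (x * y * (x * y)⁻¹) = (x * x⁻¹ * x) * (y * (x * y)⁻¹) := by
        simp only [mul_assoc]
    _ = x * y * (x * y)⁻¹ := by rw [mul_inv_mul, mul_assoc]

/-- If the idempotent `e` is below the range of `x * y`, then it is below that of `x`. -/
theorem le_range_of_mul {e x y : S} (h : e * (x * y * (x * y)⁻¹) = e) : e * (x * x⁻¹) = e := by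
  have h' : e * (x * y * (x * y)⁻¹ * (x * x⁻¹)) = e := by
    rw [idem_comm (mul_inv_idem (x * y)) (mul_inv_idem x), mul_mul_mul_inv, h]
  rwa [← mul_assoc e, h] at h'

/-- The range of `e * x` is `e` as soon as the idempotent `e` is below the range of `x`. -/
theorem range_of_le {e x : S} (he : e * e = e) (h : e * (x * x⁻¹) = e) :
    e * x * (e * x)⁻¹ = e := by
  rw [InverseMonoid.mul_inv_rev, idem_inv he]
  calc e * x * (x⁻¹ * e) = e * (x * x⁻¹) * e := by simp only [mul_assoc]
    _ = e := by rw [h, he]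

/-- An idempotent equal to the range of `e * x` is below the range of `x`. -/
theorem le_of_range {e x : S} (he : e * e = e) (h : e * x * (e * x)⁻¹ = e) :
    e * (x * x⁻¹) = e := by
  rw [InverseMonoid.mul_inv_rev, idem_inv he] at h
  calc e * (x * x⁻¹) = e * (e * (x * x⁻¹)) := by rw [← mul_assoc e e, he]
    _ = e * x * (x⁻¹ * e) := by rw [idem_comm he (mul_inv_idem x)]; simp only [mul_assoc]
    _ = e := h

end InverseMonoid

open InverseMonoid

/-- The element `f = x⁻¹ * y` maps to `1`, so it is idempotent, and `x * f = y` since the ranges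
agree. Substituting `x * f` for `y` in `x = y * y⁻¹ * x` and commuting idempotents leaves `x * f`.
This is the form in which `E`-unitarity makes vertices over one group element coincide. -/
theorem IsEUnitary.eq_of_range_eq {S : Type*} [InverseMonoid S] (hS : IsEUnitary S) {x y : S}
    (h : x * x⁻¹ = y * y⁻¹) (hσ : toGroupImage S x = toGroupImage S y) : x = y := by
  have hf : x⁻¹ * y * (x⁻¹ * y) = x⁻¹ * y :=
    (hS _).1 (by rw [map_mul, toGroupImage_inv, hσ, inv_mul_cancel])
  have hy : x * (x⁻¹ * y) = y := by rw [← mul_assoc, h, mul_inv_mul]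
  calc x = y * y⁻¹ * x := by rw [← h, mul_inv_mul]
    _ = x * (x⁻¹ * y) * (x * (x⁻¹ * y))⁻¹ * x := by rw [hy]
    _ = x * ((x⁻¹ * y) * (x⁻¹ * y) * (x⁻¹ * x)) := by
        rw [InverseMonoid.mul_inv_rev, idem_inv hf]; simp only [mul_assoc]
    _ = x * x⁻¹ * x * (x⁻¹ * y) := by
        rw [hf, idem_comm hf (inv_mul_idem x)]; simp only [mul_assoc]
    _ = y := by rw [mul_inv_mul, hy]

/-! ### Words and paths -/

/-- The formal inverse of a word. -/
def wordInv {X : Type*} (w : List (X × Bool)) : List (X × Bool) := (w.map letterInv).reverse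

section Words

variable {X : Type*}

theorem wordVal_nil {M : Type*} [Monoid M] [Inv M] (ι : X → M) : wordVal ι [] = 1 := rfl

theorem wordVal_cons {M : Type*} [Monoid M] [Inv M] (ι : X → M) (a : X × Bool)
    (w : List (X × Bool)) : wordVal ι (a :: w) = letterVal ι a * wordVal ι w := by
  simp [wordVal]

theorem wordVal_append {M : Type*} [Monoid M] [Inv M] (ι : X → M) (w w' : List (X × Bool)) :
    wordVal ι (w ++ w') = wordVal ι w * wordVal ι w' := by
  simp [wordVal]

theorem wordInv_cons (a : X × Bool) (w : List (X × Bool)) :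
    wordInv (a :: w) = wordInv w ++ [letterInv a] := by simp [wordInv]

theorem wordVal_wordInv {S : Type*} [InverseMonoid S] (ι : X → S) (w : List (X × Bool)) :
    wordVal ι (wordInv w) = (wordVal ι w)⁻¹ := by
  induction w with
  | nil => exact one_inv.symm
  | cons a w ih =>
    rw [wordInv_cons, wordVal_append, wordVal_cons, wordVal_cons, wordVal_nil, mul_one, ih,
      letterVal_letterInv', InverseMonoid.mul_inv_rev]

theorem wordVal_wordInv_group {G : Type*} [Group G] (ι : X → G) (w : List (X × Bool)) :
    wordVal ι (wordInv w) = (wordVal ι w)⁻¹ := by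
  induction w with
  | nil => exact inv_one.symm
  | cons a w ih =>
    rw [wordInv_cons, wordVal_append, wordVal_cons, wordVal_cons, wordVal_nil, mul_one, ih,
      letterVal_letterInv, mul_inv_rev]

/-- The values of words form a submonoid; `hinv` makes it closed under inversion. Leaving `hinv` as
a hypothesis lets the lemma serve inverse monoids and groups alike. -/
theorem IsGeneratedBy.exists_wordVal_eq {M : Type*} [Monoid M] [Inv M] {ι : X → M}
    (hι : IsGeneratedBy ι) (hinv : ∀ w, wordVal ι (wordInv w) = (wordVal ι w)⁻¹) (s : M) :
    ∃ w, wordVal ι w = s := by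
  have := hι
    { carrier := {s | ∃ w, wordVal ι w = s}
      one_mem' := ⟨[], rfl⟩
      mul_mem' := by
        rintro _ _ ⟨w, rfl⟩ ⟨w', rfl⟩
        exact ⟨w ++ w', wordVal_append ι w w'⟩ }
    (fun x => ⟨[(x, true)], by simp [wordVal, letterVal]⟩)
    (by rintro _ ⟨w, rfl⟩; exact ⟨wordInv w, hinv w⟩)
  have hs : s ∈ (⊤ : Submonoid M) := trivial
  rwa [← this] at hs

theorem IsGeneratedBy.exists_word {S : Type*} [InverseMonoid S] {ι : X → S}
    (hι : IsGeneratedBy ι) (s : S) : ∃ w, wordVal ι w = s :=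
  hι.exists_wordVal_eq (wordVal_wordInv ι) s

theorem IsGeneratedBy.groupGen {S : Type*} [InverseMonoid S] {ι : X → S}
    (hι : IsGeneratedBy ι) : IsGeneratedBy (groupGen ι) := by
  intro T hT hinv
  have := hι (T.comap (toGroupImage S)) hT fun a ha => hinv _ ha
  refine eq_top_iff.2 fun g _ => ?_
  induction g using Quotient.inductionOn' with
  | h s =>
    have hs : s ∈ T.comap (toGroupImage S) := by rw [this]; trivial
    exact hs

theorem toGroupImage_wordVal {S : Type*} [InverseMonoid S] (ι : X → S) (w : List (X × Bool)) :
    toGroupImage S (wordVal ι w) = wordVal (groupGen ι) w := by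
  induction w with
  | nil => exact map_one _
  | cons a w ih => rw [wordVal_cons, wordVal_cons, map_mul, toGroupImage_letterVal, ih]

end Words

/-! ### Paths in subgraphs of a Cayley graph. -/

namespace CayleySubgraph

variable {X G : Type*} [Group G] {ι : X → G} {Δ : CayleySubgraph ι}

theorem IsPath.source {w : List (X × Bool)} {g h : G} (hp : Δ.IsPath g w h) : g ∈ Δ.verts := by
  cases w with
  | nil => exact hp.1
  | cons a w => exact Δ.source_mem _ _ hp.1

theorem IsPath.target {w : List (X × Bool)} : ∀ {g h : G}, Δ.IsPath g w h → h ∈ Δ.verts := by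
  induction w with
  | nil => rintro g h ⟨hg, rfl⟩; exact hg
  | cons a w ih => exact fun hp => ih hp.2

theorem IsPath.eq {w : List (X × Bool)} :
    ∀ {g h : G}, Δ.IsPath g w h → g * wordVal ι w = h := by
  induction w with
  | nil => rintro g h ⟨-, rfl⟩; exact mul_one g
  | cons a w ih => intro g h hp; rw [wordVal_cons, ← mul_assoc]; exact ih hp.2

/-- The Cayley graph is deterministic, so the intermediate vertex is forced and needs no existential
quantifier. -/
theorem isPath_append {w w' : List (X × Bool)} : ∀ {g h : G},
    Δ.IsPath g (w ++ w') h ↔ Δ.IsPath g w (g * wordVal ι w) ∧ Δ.IsPath (g * wordVal ι w) w' h := by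
  intro g h
  refine ⟨fun hp => ?_, fun hp => hp.1.append hp.2⟩
  induction w generalizing g with
  | nil =>
    rw [wordVal_nil, mul_one]
    exact ⟨⟨IsPath.source hp, rfl⟩, hp⟩
  | cons a w ih =>
    rw [wordVal_cons, ← mul_assoc]
    exact ⟨⟨hp.1, (ih hp.2).1⟩, (ih hp.2).2⟩

theorem isPath_singleton {g h : G} {a : X × Bool} :
    Δ.IsPath g [a] h ↔ (g, a) ∈ Δ.edges ∧ g * letterVal ι a = h :=
  ⟨fun hp => ⟨hp.1, hp.2.2⟩, fun hp => ⟨hp.1, Δ.target_mem _ _ hp.1, hp.2⟩⟩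

theorem IsPath.reverse {w : List (X × Bool)} :
    ∀ {g h : G}, Δ.IsPath g w h → Δ.IsPath h (wordInv w) g := by
  induction w with
  | nil => rintro g h ⟨hg, rfl⟩; exact ⟨hg, rfl⟩
  | cons a w ih =>
    intro g h hp
    rw [wordInv_cons]
    exact (ih hp.2).append
      (isPath_singleton.2 ⟨Δ.inv_mem _ _ hp.1, by simp [letterVal_letterInv]⟩)

theorem isPath_translate {x g h : G} {w : List (X × Bool)} :
    (Δ.translate x).IsPath g w h ↔ Δ.IsPath (x⁻¹ * g) w (x⁻¹ * h) := by
  refine ⟨fun hp => ?_, fun hp => by simpa using hp.translate x⟩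
  have := hp.translate x⁻¹
  rwa [show (Δ.translate x).translate x⁻¹ = Δ by simp [CayleySubgraph.translate]] at this

end CayleySubgraph

/-! ### Finite subgraphs spanned by paths. -/

namespace CSub

variable {X G : Type*} [Group G] {ι : X → G}

/-- A path spans a finite connected subgraph. -/
theorem exists_spanned (Δ : CayleySubgraph ι) {w : List (X × Bool)} :
    ∀ {g h : G}, Δ.IsPath g w h → ∃ F : CSub ι, F.1.IsFinite ∧ F.1.IsPath g w h ∧
      ∀ Ξ : CSub ι, Ξ.1.IsPath g w h → F ≤ Ξ := by
  induction w with
  | nil =>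
    rintro g h ⟨-, rfl⟩
    refine ⟨g • single ι, CayleySubgraph.IsFinite.translate
      ⟨Set.finite_singleton 1, Set.finite_empty⟩ g, ⟨?_, rfl⟩, fun Ξ hΞ => ?_⟩
    · rw [mem_smul, inv_mul_cancel]; rfl
    · rw [smul_le_iff]
      exact single_le (by rw [mem_smul, inv_inv, mul_one]; exact hΞ.1)
  | cons a w ih =>
    intro g h hp
    obtain ⟨F, h1, h2, h3⟩ := ih hp.2
    refine ⟨union ⟨_, CayleySubgraph.edgeGraph_isConnected g a⟩ F (g * letterVal ι a) (Or.inr rfl)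
      h2.source, (CayleySubgraph.edgeGraph_isFinite g a).union h1,
      ⟨Or.inl (Or.inl rfl), h2.mono (right_le _ _ _ _ _)⟩, fun Ξ hΞ => ?_⟩
    exact union_le (CayleySubgraph.edgeGraph_le hΞ.1) (h3 Ξ hΞ.2)

/-- A finite set of paths issuing from a vertex can be traversed by a single closed path. -/
theorem exists_loop {Δ : CayleySubgraph ι} {v : G} (hv : v ∈ Δ.verts)
    {Q : Set (List (X × Bool))} (hQ : Q.Finite) :
    (∀ q ∈ Q, Δ.IsPath v q (v * wordVal ι q)) → ∃ w, Δ.IsPath v w v ∧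
      ∀ Ξ : CayleySubgraph ι, Ξ.IsPath v w v → ∀ q ∈ Q, Ξ.IsPath v q (v * wordVal ι q) := by
  induction Q, hQ using Set.Finite.induction_on with
  | empty => exact fun _ => ⟨[], ⟨hv, rfl⟩, fun _ _ _ h => h.elim⟩
  | @insert q Q _ _ ih =>
    intro h
    obtain ⟨w, h1, h2⟩ := ih fun q hq => h q (Or.inr hq)
    have hq := h q (Or.inl rfl)
    refine ⟨w ++ (q ++ wordInv q), h1.append (hq.append hq.reverse), fun Ξ hΞ => ?_⟩
    rw [CayleySubgraph.isPath_append, h1.eq, CayleySubgraph.isPath_append] at hΞ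
    rintro r (rfl | hr)
    exacts [hΞ.2.1, h2 Ξ hΞ.1 r hr]

/-- A finite connected subgraph is spanned by a closed path at any of its vertices. -/
theorem exists_spanning_loop {F : CSub ι} (hF : F.1.IsFinite) {v : G} (hv : v ∈ F.1.verts) :
    ∃ w, F.1.IsPath v w v ∧ ∀ Ξ : CSub ι, Ξ.1.IsPath v w v → F ≤ Ξ := by
  choose p hp using fun g (hg : g ∈ F.1.verts) => F.2.2 v hv g hg
  obtain ⟨w, h1, h2⟩ := exists_loop (Δ := F.1) hv
    -- One path from `v` to each vertex, and for each edge the chosen path to its source followed by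
    -- the edge itself.
    (Q := {q | ∃ g hg, p g hg = q} ∪
      {q | ∃ e : F.1.edges, p e.1.1 (F.1.source_mem _ _ e.2) ++ [e.1.2] = q})
    (by
      have := hF.1.to_subtype
      have := hF.2.to_subtype
      refine Set.Finite.union ?_ (Set.finite_range _)
      refine (Set.finite_range fun g : F.1.verts => p g.1 g.2).subset ?_
      rintro _ ⟨g, hg, rfl⟩
      exact ⟨⟨g, hg⟩, rfl⟩)
    (by
      rintro _ (⟨g, hg, rfl⟩ | ⟨⟨⟨g, a⟩, he⟩, rfl⟩)
      · rw [(hp g hg).eq]; exact hp g hg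
      · have hg := hp g (F.1.source_mem _ _ he)
        rw [wordVal_append, ← mul_assoc, hg.eq]
        exact hg.append (CayleySubgraph.isPath_singleton.2 ⟨he, by simp [wordVal]⟩))
  refine ⟨w, h1, fun Ξ hΞ => ⟨fun g hg => ?_, ?_⟩⟩
  · have := (h2 Ξ.1 hΞ _ (Or.inl ⟨g, hg, rfl⟩)).target
    rwa [(hp g hg).eq] at this
  · rintro ⟨g, a⟩ he
    have := h2 Ξ.1 hΞ _ (Or.inr ⟨⟨_, he⟩, rfl⟩)
    rw [CayleySubgraph.isPath_append, (hp g (F.1.source_mem _ _ he)).eq] at this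
    exact this.2.1

end CSub

/-! ### Graphs determined by sets of idempotents -/

section IdemGraph

variable {S : Type*} [InverseMonoid S]

/-- `Reaches A v k s`: some `t` with `v σ♯(t) = k` has the range of `t * s` above an element of the
set `A` of idempotents. -/
def Reaches (A : Set S) (v k : GroupImage S) (s : S) : Prop :=
  ∃ e ∈ A, ∃ t, v * toGroupImage S t = k ∧ e * (t * s * (t * s)⁻¹) = e

/-- A multiplicatively closed non-empty set of idempotents. -/
structure IsIdemSemilattice (A : Set S) : Prop where
  nonempty : A.Nonempty
  idem : ∀ e ∈ A, e * e = e
  mul_mem : ∀ e ∈ A, ∀ f ∈ A, e * f ∈ A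

theorem isIdemSemilattice_singleton {e : S} (he : e * e = e) : IsIdemSemilattice {e} where
  nonempty := ⟨e, rfl⟩
  idem := by rintro _ rfl; exact he
  mul_mem := by rintro _ rfl _ rfl; exact he

variable {A : Set S} {v k : GroupImage S}

theorem Reaches.left {s s' : S} (h : Reaches A v k (s * s')) : Reaches A v k s := by
  obtain ⟨e, he, t, ht, h⟩ := h
  rw [← mul_assoc t s] at h
  exact ⟨e, he, t, ht, le_range_of_mul h⟩

theorem Reaches.right {s s' : S} (h : Reaches A v k (s * s')) :
    Reaches A v (k * toGroupImage S s) s' := by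
  obtain ⟨e, he, t, ht, h⟩ := h
  exact ⟨e, he, t * s, by rw [map_mul, ← mul_assoc, ht], by rwa [mul_assoc t]⟩

theorem Reaches.one {s : S} (h : Reaches A v k s) : Reaches A v k 1 := by
  rw [← one_mul s] at h
  exact h.left

theorem Reaches.mul_inv {s : S} (h : Reaches A v k s) : Reaches A v k (s * s⁻¹) := by
  obtain ⟨e, he, t, ht, h⟩ := h
  refine ⟨e, he, t, ht, ?_⟩
  have : t * (s * s⁻¹) * (t * (s * s⁻¹))⁻¹ = t * s * (t * s)⁻¹ := by
    rw [InverseMonoid.mul_inv_rev, idem_inv (mul_inv_idem s), InverseMonoid.mul_inv_rev]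
    calc t * (s * s⁻¹) * (s * s⁻¹ * t⁻¹) = t * (s * s⁻¹ * (s * s⁻¹)) * t⁻¹ := by
          simp only [mul_assoc]
      _ = t * s * (s⁻¹ * t⁻¹) := by rw [mul_inv_idem]; simp only [mul_assoc]
  rwa [this]

/-- Since `t * s` and `t * (s * s⁻¹)` have the same range, `s` may be followed by `s⁻¹`. This makes
the edges of `idemGraph` closed under inversion. -/
theorem Reaches.inv {s : S} (h : Reaches A v k s) : Reaches A v (k * toGroupImage S s) s⁻¹ :=
  h.mul_inv.right

/-- The two hypotheses come with unrelated idempotents `e`, `e'` and witnesses `t`, `t'`. Below `e *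
e'`, which is again in `A`, the elements `t * s` and `t'` become equal, and the second condition
transfers from `t'` to `t * s`. -/
theorem Reaches.mul (hS : IsEUnitary S) (hA : IsIdemSemilattice A) {s s' : S}
    (h : Reaches A v k s) (h' : Reaches A v (k * toGroupImage S s) s') :
    Reaches A v k (s * s') := by
  obtain ⟨e, he, t, ht, h⟩ := h
  obtain ⟨e', he', t', ht', h'⟩ := h'
  have hf := hA.idem _ (hA.mul_mem e he e' he')
  have hc := idem_comm (hA.idem e he) (hA.idem e' he')
  have h1 : e * e' * (t * s * (t * s)⁻¹) = e * e' := by rw [hc, mul_assoc, h]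
  have h2 : e * e' * (t' * s' * (t' * s')⁻¹) = e * e' := by rw [mul_assoc, h']
  -- Both sides have range `e * e'`, and `t * s` and `t'` have the same image because both lead from
  -- `v` to the same vertex.
  have hts : e * e' * (t * s) = e * e' * t' := by
    refine hS.eq_of_range_eq ?_ ?_
    · rw [range_of_le hf h1, range_of_le hf (le_range_of_mul h2)]
    · rw [map_mul, map_mul _ _ t']
      congr 1
      exact mul_left_cancel (a := v) (by rw [map_mul, ← mul_assoc, ht, ht'])
  refine ⟨e * e', hA.mul_mem e he e' he', t, ht, le_of_range hf ?_⟩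
  rw [← mul_assoc t, ← mul_assoc (e * e'), hts, mul_assoc _ t', range_of_le hf h2]

variable {X : Type*} {ι : X → S}

/-- The subgraph of the points reached from `v` through `A`. -/
def idemGraph (ι : X → S) (A : Set S) (v : GroupImage S) : CayleySubgraph (groupGen ι) where
  verts := {k | Reaches A v k 1}
  edges := {e | Reaches A v e.1 (letterVal ι e.2)}
  source_mem _ _ h := h.one
  target_mem g a h := by
    rw [← toGroupImage_letterVal]
    exact h.inv.one
  inv_mem g a h := by
    simp only [Set.mem_ofPred_eq]
    rw [← toGroupImage_letterVal, letterVal_letterInv']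
    exact h.inv

/-- The right-hand side mentions `w` only through its value in `S`; closedness of the graph is
immediate from this. -/
theorem isPath_idemGraph (hS : IsEUnitary S) (hA : IsIdemSemilattice A) {w : List (X × Bool)} :
    ∀ {k h : GroupImage S}, (idemGraph ι A v).IsPath k w h ↔
      k * toGroupImage S (wordVal ι w) = h ∧ Reaches A v k (wordVal ι w) := by
  induction w with
  | nil =>
    intro k h
    rw [wordVal_nil, map_one, mul_one]
    exact and_comm
  | cons a w ih =>
    intro k h
    change Reaches A v k (letterVal ι a) ∧ (idemGraph ι A v).IsPath _ w h ↔ _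
    rw [ih, wordVal_cons, map_mul, ← toGroupImage_letterVal, mul_assoc]
    exact ⟨fun h => ⟨h.2.1, h.1.mul hS hA h.2.2⟩, fun h => ⟨h.2.left, h.1, h.2.right⟩⟩

/-- A witness `t` for a vertex, spelled as a word, labels a path to that vertex from `v`. -/
theorem idemGraph_isConnected (hS : IsEUnitary S) (hA : IsIdemSemilattice A)
    (hι : IsGeneratedBy ι) : (idemGraph ι A v).IsConnected := by
  have hv : v ∈ (idemGraph ι A v).verts := by
    obtain ⟨e, he⟩ := hA.nonempty
    exact ⟨e, he, 1, by rw [map_one, mul_one], by rw [mul_one, one_inv, mul_one, mul_one]⟩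
  have key : ∀ k ∈ (idemGraph ι A v).verts, ∃ w, (idemGraph ι A v).IsPath v w k := by
    rintro k ⟨e, he, t, ht, h⟩
    obtain ⟨w, rfl⟩ := hι.exists_word t
    refine ⟨w, (isPath_idemGraph hS hA).2 ⟨ht, e, he, 1, by rw [map_one, mul_one], ?_⟩⟩
    rwa [one_mul, ← mul_one (wordVal ι w)]
  exact CayleySubgraph.isConnected_of_vertex hv
    (fun k hk => (key k hk).imp' wordInv fun _ h => h.reverse) key

/-- `idemGraph` as an element of `CSub`. -/
def idemCSub (hS : IsEUnitary S) (hA : IsIdemSemilattice A) (hι : IsGeneratedBy ι)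
    (v : GroupImage S) : CSub (groupGen ι) :=
  ⟨idemGraph ι A v, idemGraph_isConnected hS hA hι⟩

theorem idemCSub_isClosedGraph (hS : IsEUnitary S) (hA : IsIdemSemilattice A)
    (hι : IsGeneratedBy ι) : IsClosedGraph ι (idemCSub hS hA hι v) := by
  intro u u' huu' g _ h _
  change (idemGraph ι A v).IsPath g u h ↔ (idemGraph ι A v).IsPath g u' h
  rw [isPath_idemGraph hS hA, isPath_idemGraph hS hA, huu']

/-- A closed graph containing closed paths at `v` with values in `A` contains everything reached
from `v` through `A`. -/
theorem IsClosedGraph.isPath_of_reaches {Ξ : CSub (groupGen ι)} (hΞ : IsClosedGraph ι Ξ)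
    (hι : IsGeneratedBy ι) (hA : ∀ e ∈ A, ∃ w, wordVal ι w = e ∧ Ξ.1.IsPath v w v)
    {w : List (X × Bool)} (h : Reaches A v k (wordVal ι w)) :
    Ξ.1.IsPath k w (k * toGroupImage S (wordVal ι w)) := by
  obtain ⟨e, he, t, rfl, h⟩ := h
  obtain ⟨p, hp, hpath⟩ := hA e he
  obtain ⟨q, rfl⟩ := hι.exists_word t
  -- The condition that `e` lies below the range of `t * s`, read as an equality of word values:
  -- closedness now turns the loop `p` into a longer loop running through `w` at `k`.
  have hval : wordVal ι p = wordVal ι (p ++ (q ++ w ++ wordInv (q ++ w))) := by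
    rw [wordVal_append, wordVal_append _ (q ++ w), wordVal_wordInv, wordVal_append, hp, h]
  have := (hΞ _ _ hval v hpath.source v hpath.source).1 hpath
  rw [CayleySubgraph.isPath_append, hpath.eq, CayleySubgraph.isPath_append,
    CayleySubgraph.isPath_append] at this
  rw [toGroupImage_wordVal, toGroupImage_wordVal]
  have h' := this.2.1.2
  rwa [wordVal_append, ← mul_assoc] at h'

theorem IsClosedGraph.idemGraph_le {Ξ : CSub (groupGen ι)} (hΞ : IsClosedGraph ι Ξ)
    (hι : IsGeneratedBy ι) (hA : ∀ e ∈ A, ∃ w, wordVal ι w = e ∧ Ξ.1.IsPath v w v) :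
    idemGraph ι A v ≤ Ξ.1 := by
  refine ⟨fun k hk => (hΞ.isPath_of_reaches hι hA (w := []) hk).source, ?_⟩
  rintro ⟨k, a⟩ h
  refine (hΞ.isPath_of_reaches hι hA (w := [a]) (k := k) ?_).1
  rw [wordVal_cons, wordVal_nil, mul_one]
  exact h

theorem IsClosedGraph.smul {Δ : CSub (groupGen ι)} (hΔ : IsClosedGraph ι Δ) (x : GroupImage S) :
    IsClosedGraph ι (x • Δ) := by
  intro u u' huu' g hg h hh
  change (Δ.1.translate x).IsPath g u h ↔ (Δ.1.translate x).IsPath g u' h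
  rw [CayleySubgraph.isPath_translate, CayleySubgraph.isPath_translate]
  exact hΔ u u' huu' _ hg _ hh

/-! ### The closure operator `c_S` -/

/-- The idempotents that are values of closed paths at `v` in `Δ`. -/
def loopIdems (ι : X → S) (Δ : CSub (groupGen ι)) (v : GroupImage S) : Set S :=
  {e | e * e = e ∧ ∃ w, wordVal ι w = e ∧ Δ.1.IsPath v w v}

theorem loopIdems_isIdemSemilattice {Δ : CSub (groupGen ι)} (hv : v ∈ Δ.1.verts) :
    IsIdemSemilattice (loopIdems ι Δ v) where
  nonempty := ⟨1, mul_one 1, [], rfl, hv, rfl⟩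
  idem _ he := he.1
  mul_mem := by
    rintro _ ⟨he, w, rfl, hw⟩ _ ⟨hf, w', rfl, hw'⟩
    refine ⟨?_, w ++ w', wordVal_append ι w w', hw.append hw'⟩
    rw [mul_assoc, ← mul_assoc (wordVal ι w'), idem_comm hf he, mul_assoc, hf, ← mul_assoc, he]

theorem range_mem_loopIdems {Δ : CSub (groupGen ι)} {w : List (X × Bool)}
    (hp : Δ.1.IsPath v w k) : wordVal ι w * (wordVal ι w)⁻¹ ∈ loopIdems ι Δ v :=
  ⟨mul_inv_idem _, w ++ wordInv w, by rw [wordVal_append, wordVal_wordInv], hp.append hp.reverse⟩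

/-- Going along a path from `v` and back is a loop whose value is the range of the path's value;
that idempotent witnesses the endpoint, and the path extended by an edge witnesses the edge. -/
theorem le_idemGraph_loopIdems {Δ : CSub (groupGen ι)} (hv : v ∈ Δ.1.verts) :
    Δ.1 ≤ idemGraph ι (loopIdems ι Δ v) v := by
  constructor
  · intro k hk
    obtain ⟨w, hw⟩ := Δ.2.2 v hv k hk
    exact ⟨_, range_mem_loopIdems hw, wordVal ι w, by rw [toGroupImage_wordVal, hw.eq],
      by rw [mul_one, mul_inv_idem]⟩
  · rintro ⟨k, a⟩ hk
    obtain ⟨w, hw⟩ := Δ.2.2 v hv k (Δ.1.source_mem _ _ hk)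
    have hwa := range_mem_loopIdems (hw.append (CayleySubgraph.isPath_singleton.2 ⟨hk, rfl⟩))
    rw [wordVal_append, wordVal_cons, wordVal_nil, mul_one] at hwa
    exact ⟨_, hwa, wordVal ι w, by rw [toGroupImage_wordVal, hw.eq], mul_inv_idem _⟩

/-- The closure operator `c_S` of a generated `E`-unitary inverse monoid `S`. -/
noncomputable def schutzenbergerClosure (hS : IsEUnitary S) (hι : IsGeneratedBy ι) :
    ClosureOperator (CSub (groupGen ι)) :=
  ClosureOperator.ofPred
    -- The base vertex is an arbitrary choice; it does not matter, as the result is the least closed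
    -- graph above `Δ`.
    (fun Δ => idemCSub hS (loopIdems_isIdemSemilattice Δ.2.1.some_mem) hι Δ.2.1.some)
    (IsClosedGraph ι) (fun Δ => le_idemGraph_loopIdems Δ.2.1.some_mem)
    (fun _ => idemCSub_isClosedGraph hS _ hι)
    -- Minimality: loops of `Δ` remain loops in any closed graph containing `Δ`.
    (fun _ _ hle hΞ => hΞ.idemGraph_le hι fun _ he => he.2.imp fun _ h => ⟨h.1, h.2.mono hle⟩)

variable (hS : IsEUnitary S) (hι : IsGeneratedBy ι)

theorem schutzenbergerClosure_eq_iff {Δ : CSub (groupGen ι)} :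
    schutzenbergerClosure hS hι Δ = Δ ↔ IsClosedGraph ι Δ :=
  (schutzenbergerClosure hS hι).isClosed_iff.symm

theorem schutzenbergerClosure_isClosedGraph (Δ : CSub (groupGen ι)) :
    IsClosedGraph ι (schutzenbergerClosure hS hι Δ) :=
  (schutzenbergerClosure_eq_iff hS hι).1 ((schutzenbergerClosure hS hι).idempotent Δ)

theorem schutzenbergerClosure_le {Δ Ξ : CSub (groupGen ι)} (h : Δ ≤ Ξ) (hΞ : IsClosedGraph ι Ξ) :
    schutzenbergerClosure hS hι Δ ≤ Ξ := by
  rw [← (schutzenbergerClosure_eq_iff hS hι).2 hΞ]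
  exact (schutzenbergerClosure hS hι).monotone h

theorem schutzenbergerClosure_gInvariant : GInvariant (schutzenbergerClosure hS hι) := by
  intro g Δ
  refine le_antisymm (schutzenbergerClosure_le hS hι
    (CSub.smul_le ((schutzenbergerClosure hS hι).le_closure Δ))
    ((schutzenbergerClosure_isClosedGraph hS hι Δ).smul g)) ?_
  rw [CSub.smul_le_iff]
  refine schutzenbergerClosure_le hS hι ?_
    ((schutzenbergerClosure_isClosedGraph hS hι _).smul g⁻¹)
  rw [← CSub.smul_le_iff]
  exact (schutzenbergerClosure hS hι).le_closure _

/-- Only one loop of `Δ` enters the hypothesis; take `F` to be the finite subgraph it spans. -/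
theorem exists_finite_of_reaches_loopIdems {Δ : CSub (groupGen ι)} {w : List (X × Bool)}
    (h : Reaches (loopIdems ι Δ v) v k (wordVal ι w)) :
    ∃ F : CSub (groupGen ι), (F.1.IsFinite ∧ F ≤ Δ) ∧ (schutzenbergerClosure hS hι F).1.IsPath k w
      (k * toGroupImage S (wordVal ι w)) := by
  obtain ⟨e, ⟨-, p, hp, hpath⟩, h⟩ := h
  obtain ⟨F, hF, h1, h2⟩ := CSub.exists_spanned Δ.1 hpath
  refine ⟨F, ⟨hF, h2 Δ hpath⟩,
    (schutzenbergerClosure_isClosedGraph hS hι F).isPath_of_reaches hι (A := {e}) ?_ ⟨e, rfl, h⟩⟩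
  rintro _ rfl
  exact ⟨p, hp, h1.mono ((schutzenbergerClosure hS hι).le_closure F)⟩

theorem schutzenbergerClosure_isFinitary : IsFinitary (schutzenbergerClosure hS hι) := by
  intro Δ
  constructor
  · refine Set.Subset.antisymm (fun k hk => ?_)
      (Set.iUnion₂_subset fun F hF => ((schutzenbergerClosure hS hι).monotone hF.2).1)
    obtain ⟨F, hF, h⟩ := exists_finite_of_reaches_loopIdems hS hι (w := []) hk
    exact Set.mem_biUnion (x := F) hF h.source
  · refine Set.Subset.antisymm ?_
      (Set.iUnion₂_subset fun F hF => ((schutzenbergerClosure hS hι).monotone hF.2).2)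
    rintro ⟨k, a⟩ hk
    have hk' : Reaches (loopIdems ι Δ Δ.2.1.some) Δ.2.1.some k (wordVal ι [a]) := by
      rw [wordVal_cons, wordVal_nil, mul_one]
      exact hk
    obtain ⟨F, hF, h⟩ := exists_finite_of_reaches_loopIdems hS hι hk'
    exact Set.mem_biUnion (x := F) hF h.1

/-! ### Schützenberger graphs as compact graphs -/

/-- Right multiplication can only lower the range, so mutual reachability forces equality;
conversely `s * (s⁻¹ * t) = t` when the ranges agree. -/
theorem sameComponent_iff (hι : IsGeneratedBy ι) {s t : S} :
    SameComponent ι s t ↔ s * s⁻¹ = t * t⁻¹ := by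
  constructor
  · rintro ⟨⟨w, rfl⟩, w', h⟩
    have h1 := mul_mul_mul_inv s (wordVal ι w)
    have h2 := mul_mul_mul_inv (s * wordVal ι w) (wordVal ι w')
    rw [h] at h2
    rw [← h2, idem_comm (mul_inv_idem _) (mul_inv_idem _), h1]
  · intro h
    obtain ⟨w, hw⟩ := hι.exists_word (s⁻¹ * t)
    obtain ⟨w', hw'⟩ := hι.exists_word (t⁻¹ * s)
    exact ⟨⟨w, by rw [hw, ← mul_assoc, h, mul_inv_mul]⟩,
      ⟨w', by rw [hw', ← mul_assoc, ← h, mul_inv_mul]⟩⟩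

theorem reaches_range_iff {s x : S} :
    Reaches {s * s⁻¹} 1 k x ↔
      ∃ t, toGroupImage S t = k ∧ s * s⁻¹ = t * t⁻¹ ∧ s * s⁻¹ = t * x * (t * x)⁻¹ := by
  constructor
  · rintro ⟨_, rfl, t, ht, h⟩
    rw [one_mul] at ht
    -- Cutting `t` down by `s * s⁻¹` keeps its image in `S/σ` and makes the range exactly `s * s⁻¹`,
    -- which places it in the strong component of `s`.
    refine ⟨s * s⁻¹ * t, ?_, (range_of_le (mul_inv_idem s) (le_range_of_mul h)).symm, ?_⟩
    · rw [map_mul, map_mul, toGroupImage_inv, mul_inv_cancel, one_mul, ht]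
    · rw [mul_assoc _ t, range_of_le (mul_inv_idem s) h]
  · rintro ⟨t, ht, -, h⟩
    exact ⟨_, rfl, t, by rw [one_mul, ht], by rw [← h, mul_inv_idem]⟩

theorem schutzenbergerGraph_eq (hι : IsGeneratedBy ι) (s : S) :
    schutzenbergerGraph ι s = idemGraph ι {s * s⁻¹} 1 := by
  ext k
  · change (∃ t, SameComponent ι s t ∧ _) ↔ Reaches _ _ _ _
    simp only [reaches_range_iff, sameComponent_iff hι, mul_one]
    exact exists_congr fun t => by tauto
  · change (∃ t, SameComponent ι s t ∧ _) ↔ Reaches _ _ _ _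
    simp only [reaches_range_iff, sameComponent_iff hι]
    exact exists_congr fun t => by tauto

/-- The image of the Schützenberger graph of `s`, as a connected subgraph. -/
def schutzenbergerCSub (s : S) : CSub (groupGen ι) :=
  idemCSub hS (isIdemSemilattice_singleton (mul_inv_idem s)) hι 1

theorem schutzenbergerCSub_isClosedGraph (s : S) :
    IsClosedGraph ι (schutzenbergerCSub hS hι s) := idemCSub_isClosedGraph hS _ hι

theorem isPath_schutzenbergerCSub {w : List (X × Bool)} {s : S} (hw : wordVal ι w = s) :
    (schutzenbergerCSub hS hι s).1.IsPath 1 w (toGroupImage S s) := by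
  refine (isPath_idemGraph hS (isIdemSemilattice_singleton (mul_inv_idem s))).2
    ⟨by rw [one_mul, hw], _, rfl, 1, by rw [map_one, mul_one], ?_⟩
  rw [one_mul, hw, mul_inv_idem]

/-- A path labelled `w` followed by its reverse is a loop at `1` of value `s * s⁻¹`, which forces
the whole Schützenberger graph. -/
theorem schutzenbergerCSub_le_iff {Ξ : CSub (groupGen ι)} (hΞ : IsClosedGraph ι Ξ)
    {w : List (X × Bool)} {s : S} (hw : wordVal ι w = s) :
    schutzenbergerCSub hS hι s ≤ Ξ ↔ Ξ.1.IsPath 1 w (toGroupImage S s) := by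
  refine ⟨fun h => (isPath_schutzenbergerCSub hS hι hw).mono h,
    fun h => hΞ.idemGraph_le hι ?_⟩
  rintro _ rfl
  exact ⟨w ++ wordInv w, by rw [wordVal_append, wordVal_wordInv, hw], h.append h.reverse⟩

theorem schutzenbergerCSub_isCompactGraph (s : S) :
    IsCompactGraph (schutzenbergerClosure hS hι) (schutzenbergerCSub hS hι s) := by
  obtain ⟨w, hw⟩ := hι.exists_word s
  have hp := isPath_schutzenbergerCSub hS hι hw
  obtain ⟨F, hF, h1, h2⟩ := CSub.exists_spanned _ hp
  refine ⟨F, hF, le_antisymm (schutzenbergerClosure_le hS hι (h2 _ hp)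
    (schutzenbergerCSub_isClosedGraph hS hι s)) ?_⟩
  exact (schutzenbergerCSub_le_iff hS hι (schutzenbergerClosure_isClosedGraph hS hι F) hw).2
    (h1.mono ((schutzenbergerClosure hS hι).le_closure F))

/-- The map `s ↦ (SΓ(s), σ♯(s))`. -/
noncomputable def toClosureMonoid (s : S) :
    ClosureMonoid (schutzenbergerClosure hS hι) (schutzenbergerClosure_gInvariant hS hι) where
  graph := schutzenbergerCSub hS hι s
  elt := toGroupImage S s
  compact := schutzenbergerCSub_isCompactGraph hS hι s
  one_mem := (isPath_schutzenbergerCSub hS hι (hι.exists_word s).choose_spec).source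
  elt_mem := (isPath_schutzenbergerCSub hS hι (hι.exists_word s).choose_spec).target

theorem IsCompactGraph.isClosedGraph {Ω : CSub (groupGen ι)}
    (hΩ : IsCompactGraph (schutzenbergerClosure hS hι) Ω) : IsClosedGraph ι Ω :=
  (schutzenbergerClosure_eq_iff hS hι).1 hΩ.closed

/-- Both graphs are compared through the compact `Ω` above them: a word for `s * t` is readable in
`Ω` from `1` iff a word for `s` is readable from `1` and a word for `t` from `σ♯(s)`. -/
theorem toClosureMonoid_mul (s t : S) :
    toClosureMonoid hS hι (s * t) = toClosureMonoid hS hι s * toClosureMonoid hS hι t := by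
  refine ClosureMonoid.eq_of (map_mul _ _ _) fun Ω hΩ => ?_
  obtain ⟨w, hw⟩ := hι.exists_word s
  obtain ⟨w', hw'⟩ := hι.exists_word t
  have hΩ' := hΩ.isClosedGraph hS hι
  have hst : wordVal ι (w ++ w') = s * t := by rw [wordVal_append, hw, hw']
  rw [ClosureMonoid.mul_le_iff hΩ, CSub.smul_le_iff]
  change schutzenbergerCSub hS hι _ ≤ Ω ↔ schutzenbergerCSub hS hι s ≤ Ω ∧
    schutzenbergerCSub hS hι t ≤ (toGroupImage S s)⁻¹ • Ω
  rw [schutzenbergerCSub_le_iff hS hι hΩ' hst, schutzenbergerCSub_le_iff hS hι hΩ' hw,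
    schutzenbergerCSub_le_iff hS hι (hΩ'.smul _) hw', CayleySubgraph.isPath_append,
    ← toGroupImage_wordVal, hw, one_mul]
  refine and_congr_right fun _ => ?_
  change _ ↔ (Ω.1.translate _).IsPath _ _ _
  rw [CayleySubgraph.isPath_translate, inv_inv, mul_one, map_mul]

theorem range_le_of_schutzenbergerCSub_le {s t : S}
    (h : schutzenbergerCSub hS hι s ≤ schutzenbergerCSub hS hι t) :
    t * t⁻¹ * (s * s⁻¹) = t * t⁻¹ := by
  obtain ⟨w, hw⟩ := hι.exists_word s
  have hp := (isPath_schutzenbergerCSub hS hι hw).mono h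
  have := ((isPath_idemGraph hS (isIdemSemilattice_singleton (mul_inv_idem t))).1 hp).2
  rw [hw] at this
  obtain ⟨_, rfl, x, hx, h⟩ := this
  rw [one_mul] at hx
  -- The witness `x` lies over the vertex `1`, so `E`-unitarity makes it idempotent, and it only
  -- shrinks the range of `s`.
  have hx' := (hS x).1 hx
  have hr : x * s * (x * s)⁻¹ = x * (s * s⁻¹) := by
    rw [InverseMonoid.mul_inv_rev, idem_inv hx', mul_assoc, ← mul_assoc s,
      ← idem_comm hx' (mul_inv_idem s), ← mul_assoc, hx']
  rw [hr] at h
  calc t * t⁻¹ * (s * s⁻¹) = t * t⁻¹ * (x * (s * s⁻¹)) * (s * s⁻¹) := by rw [h]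
    _ = t * t⁻¹ * (x * (s * s⁻¹ * (s * s⁻¹))) := by simp only [mul_assoc]
    _ = t * t⁻¹ := by rw [mul_inv_idem, h]

theorem toClosureMonoid_injective : Function.Injective (toClosureMonoid hS hι) := by
  intro s t hst
  have h1 := range_le_of_schutzenbergerCSub_le hS hι (ClosureMonoid.graph_le_of_eq hst)
  have h2 := range_le_of_schutzenbergerCSub_le hS hι (ClosureMonoid.graph_le_of_eq hst.symm)
  refine hS.eq_of_range_eq ?_ (congrArg ClosureMonoid.elt hst)
  rw [← h2, idem_comm (mul_inv_idem s) (mul_inv_idem t), h1]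

theorem toClosureMonoid_surjective : Function.Surjective (toClosureMonoid hS hι) := by
  intro p
  obtain ⟨F, hF, h1F, hcF⟩ := p.compact.exists_finite p.one_mem
  have hcl := p.compact.isClosedGraph hS hι
  have hFp : F ≤ p.graph := hcF ▸ (schutzenbergerClosure hS hι).le_closure F
  obtain ⟨w, hw, hspan⟩ := CSub.exists_spanning_loop hF h1F
  obtain ⟨u, hu⟩ := p.graph.2.2 1 p.one_mem p.elt p.elt_mem
  -- The preimage is the value of this word: the loop `w` forces `F`, hence its closure, into the
  -- Schützenberger graph, and `u` adjusts the endpoint to `p.elt`.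
  have hpath := (hw.mono hFp).append hu
  have helt : toGroupImage S (wordVal ι (w ++ u)) = p.elt := by
    rw [toGroupImage_wordVal, ← one_mul (wordVal _ _), hpath.eq]
  refine ⟨wordVal ι (w ++ u), ClosureMonoid.ext (le_antisymm ?_ ?_) helt⟩
  · refine (schutzenbergerCSub_le_iff hS hι hcl rfl).2 ?_
    rwa [helt]
  · rw [← hcF]
    refine schutzenbergerClosure_le hS hι (hspan _ ?_) (schutzenbergerCSub_isClosedGraph hS hι _)
    have := isPath_schutzenbergerCSub hS hι (w := w ++ u) rfl
    rw [CayleySubgraph.isPath_append, hw.eq] at this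
    exact this.1

/-- The isomorphism `s ↦ (SΓ(s), σ♯(s))` from `S` onto `S_c`. -/
noncomputable def closureMonoidEquiv :
    S ≃* ClosureMonoid (schutzenbergerClosure hS hι) (schutzenbergerClosure_gInvariant hS hι) :=
  { Equiv.ofBijective _ ⟨toClosureMonoid_injective hS hι, toClosureMonoid_surjective hS hι⟩ with
    map_mul' := toClosureMonoid_mul hS hι }

end IdemGraph

/-! ### `S_c` as a `P`-semigroup -/

section ClosureTriple

variable {X G : Type*} [Group G] {ι : X → G} {c : ClosureOperator (CSub ι)} {hc : GInvariant c}

theorem closureMonoid_idem_of_elt {p : ClosureMonoid c hc} (h : p.elt = 1) : p * p = p := by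
  refine ClosureMonoid.eq_of (by rw [ClosureMonoid.mul_elt, h, mul_one]) fun Ω hΩ => ?_
  rw [ClosureMonoid.mul_le_iff hΩ, h, one_smul, and_self]

/-- The second projection is a homomorphism to a group, so its kernel contains `σ`; an element over
`1 ∈ G` is idempotent because `Δ ∪ Δ = Δ` is already closed. -/
theorem closureMonoid_isEUnitary : IsEUnitary (ClosureMonoid c hc) := by
  intro p
  refine ⟨fun h => closureMonoid_idem_of_elt ?_, fun h => (minGroupCon _).eq.2 (minGroupCon_idem h)⟩
  let f : ClosureMonoid c hc →* G :=
    { toFun := ClosureMonoid.elt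
      map_one' := rfl
      map_mul' := fun _ _ => rfl }
  have hp : minGroupCon _ p 1 := (minGroupCon _).eq.1 h
  exact minGroupCon_iff.1 hp (Con.ker f) fun a =>
    ⟨a⁻¹, mul_inv_cancel a.elt, inv_mul_cancel a.elt⟩

/-- The whole Cayley graph. -/
def cayleyGraph (ι : X → G) : CayleySubgraph ι where
  verts := Set.univ
  edges := Set.univ
  source_mem _ _ _ := trivial
  target_mem _ _ _ := trivial
  inv_mem _ _ _ := trivial

theorem isPath_cayleyGraph {w : List (X × Bool)} :
    ∀ {g : G}, (cayleyGraph ι).IsPath g w (g * wordVal ι w) := by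
  induction w with
  | nil => intro g; exact ⟨trivial, (mul_one g).symm⟩
  | cons a w ih =>
    intro g
    rw [wordVal_cons, ← mul_assoc]
    exact ⟨trivial, ih⟩

theorem IsGeneratedBy.exists_finite_mem (hι : IsGeneratedBy ι) (g : G) :
    ∃ F : CSub ι, F.1.IsFinite ∧ 1 ∈ F.1.verts ∧ g ∈ F.1.verts := by
  obtain ⟨w, rfl⟩ := hι.exists_wordVal_eq (wordVal_wordInv_group ι) g
  have hp := isPath_cayleyGraph (ι := ι) (w := w) (g := 1)
  rw [one_mul] at hp
  obtain ⟨F, hF, h, -⟩ := CSub.exists_spanned _ hp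
  exact ⟨F, hF, h.source, h.target⟩

/-- Under reverse inclusion a lower bound is a compact, hence closed, graph containing both. The
common vertex `v` is arbitrary: `1` serves for meets in `𝒴`, and `p.elt` for products. -/
theorem isGLB_union {Δ Ξ M : CompactGraphs c hc} {v : G} (h1 : v ∈ Δ.graph.1.verts)
    (h2 : v ∈ Ξ.graph.1.verts) (hM : M.graph = c (Δ.graph.union Ξ.graph v h1 h2)) :
    IsGLB {Δ, Ξ} M := by
  constructor
  · rintro _ (rfl | rfl)
    · exact ((CSub.left_le _ _ _ _ _).trans (c.le_closure _)).trans_eq hM.symm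
    · exact ((CSub.right_le _ _ _ _ _).trans (c.le_closure _)).trans_eq hM.symm
  · intro Ω hΩ
    exact hM.trans_le (Ω.compact.closure_le
      (CSub.union_le (hΩ (Set.mem_insert _ _)) (hΩ (Set.mem_insert_of_mem _ rfl))))

theorem exists_isGLB_compactGraphsOne (Δ Ξ : CompactGraphs c hc)
    (hΔ : Δ ∈ compactGraphsOne c hc) (hΞ : Ξ ∈ compactGraphsOne c hc) :
    ∃ M ∈ compactGraphsOne c hc, IsGLB {Δ, Ξ} M ∧
      M.graph = c (Δ.graph.union Ξ.graph 1 hΔ hΞ) :=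
  ⟨⟨_, Δ.compact.union Ξ.compact hΔ hΞ⟩, (c.le_closure _).1 (Or.inl hΔ), isGLB_union hΔ hΞ rfl,
    rfl⟩

theorem isMcAlisterTriple_compactGraphs (hι : IsGeneratedBy ι) :
    IsMcAlisterTriple G (compactGraphsOne c hc) where
  smul_le_smul _ _ _ h := CSub.smul_le h
  isLowerSet _ _ hle h := hle.1 h
  exists_meet := by
    rintro ⟨y, hy⟩ ⟨z, hz⟩
    obtain ⟨m, hm, ⟨hlb, hgr⟩, -⟩ := exists_isGLB_compactGraphsOne y z hy hz
    refine ⟨⟨m, hm⟩, ?_, fun x hx => hgr ?_⟩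
    · rintro _ (rfl | rfl)
      exacts [hlb (Set.mem_insert _ _), hlb (Set.mem_insert_of_mem _ rfl)]
    · rintro _ (rfl | rfl)
      exacts [hx (Set.mem_insert _ _), hx (Set.mem_insert_of_mem _ rfl)]
  exists_smul_eq x := by
    obtain ⟨g, hg⟩ := x.graph.2.1
    refine ⟨g, g⁻¹ • x, ?_, smul_inv_smul g x⟩
    change g⁻¹⁻¹ * 1 ∈ x.graph.1.verts
    rwa [inv_inv, mul_one]
  exists_smul_mem g := by
    -- A translate `gΔ` contains `1` iff `Δ` contains `g⁻¹`.
    obtain ⟨F, hF, h1, h2⟩ := hι.exists_finite_mem g⁻¹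
    refine ⟨⟨c F, F, hF, rfl⟩, (c.le_closure F).1 h1, ?_⟩
    change g⁻¹ * 1 ∈ (c F).1.verts
    rw [mul_one]
    exact (c.le_closure F).1 h2

theorem PSemigroup.isGLB_mul {𝒳 : Type*} [PartialOrder 𝒳] [MulAction G 𝒳] {𝒴 : Set 𝒳}
    {hT : IsMcAlisterTriple G 𝒴} (p q : PSemigroup hT) :
    IsGLB {p.fst, p.snd • q.fst} (p * q).fst :=
  (hT.exists_isGLB p q).choose_spec

/-- The identity map on pairs, from `S_c` to the `P`-semigroup of compact graphs. -/
noncomputable def closureMonoidEquivPSemigroup (hT : IsMcAlisterTriple G (compactGraphsOne c hc)) :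
    ClosureMonoid c hc ≃* PSemigroup hT where
  toFun p :=
    { fst := ⟨p.graph, p.compact⟩
      snd := p.elt
      mem := by
        refine ⟨⟨p.elt⁻¹ • ⟨p.graph, p.compact⟩, ?_, smul_inv_smul _ _⟩, p.one_mem⟩
        change p.elt⁻¹⁻¹ * 1 ∈ p.graph.1.verts
        rw [inv_inv, mul_one]
        exact p.elt_mem }
  invFun q :=
    { graph := q.fst.graph
      elt := q.snd
      compact := q.fst.compact
      one_mem := q.mem.2
      elt_mem := by
        obtain ⟨⟨y, hy, h⟩, -⟩ := q.mem
        rw [← h]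
        change q.snd⁻¹ * q.snd ∈ y.graph.1.verts
        rw [inv_mul_cancel]
        exact hy }
  left_inv _ := rfl
  right_inv _ := rfl
  map_mul' p q := by
    refine PSemigroup.ext ?_ rfl
    -- The product in the `P`-semigroup is a chosen greatest lower bound, so it is identified by
    -- uniqueness.
    refine IsGLB.unique (isGLB_union (v := p.elt) p.elt_mem (ClosureMonoid.mem_smul_graph p q) rfl)
      (PSemigroup.isGLB_mul _ _)

end ClosureTriple

theorem mainTheorem8 :
    -- every E-unitary inverse monoid is isomorphic to a P-semigroup
    (∀ (S : Type u) [InverseMonoid S], IsEUnitary S →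
      ∃ (G : Type u) (_ : Group G) (𝒳 : Type u) (_ : PartialOrder 𝒳) (_ : MulAction G 𝒳)
        (𝒴 : Set 𝒳) (hT : IsMcAlisterTriple G 𝒴), Nonempty (S ≃* PSemigroup hT)) ∧
    -- an X-generated E-unitary inverse monoid S is isomorphic to S_c for c = c_S,
    -- and hence to the P-semigroup of compact subgraphs
    (∀ (S : Type u) [InverseMonoid S], IsEUnitary S →
      ∀ (X : Type v) (ι : X → S), IsGeneratedBy ι →
      ∃ (c : ClosureOperator (CSub (groupGen ι))) (hc : GInvariant c),
        IsFinitary c ∧ (∀ Δ, c Δ = Δ ↔ IsClosedGraph ι Δ) ∧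
        (∃ ψ : S ≃* ClosureMonoid c hc, ∀ s,
          (ψ s).graph.1 = schutzenbergerGraph ι s ∧ (ψ s).elt = toGroupImage S s) ∧
        ∃ (hT : IsMcAlisterTriple (GroupImage S) (compactGraphsOne c hc))
          (θ : S ≃* PSemigroup hT), ∀ s,
          (θ s).fst.graph.1 = schutzenbergerGraph ι s ∧ (θ s).snd = toGroupImage S s) ∧
    -- S_c is the P-semigroup of (G, 𝒴, 𝒳), with 𝒳 the compact subgraphs under reverse inclusion
    (∀ (G : Type u) [Group G] (X : Type v) (ι : X → G), IsGeneratedBy ι →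
      ∀ (c : ClosureOperator (CSub ι)) (hc : GInvariant c), IsFinitary c →
        IsEUnitary (ClosureMonoid c hc) ∧
        ∃ hT : IsMcAlisterTriple G (compactGraphsOne c hc),
          (∀ (Δ Ξ : CompactGraphs c hc) (hΔ : Δ ∈ compactGraphsOne c hc)
            (hΞ : Ξ ∈ compactGraphsOne c hc),
            ∃ M ∈ compactGraphsOne c hc, IsGLB {Δ, Ξ} M ∧
              M.graph = c (Δ.graph.union Ξ.graph 1 hΔ hΞ)) ∧
          ∃ φ : ClosureMonoid c hc ≃* PSemigroup hT, ∀ p,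
            (φ p).fst.graph = p.graph ∧ (φ p).snd = p.elt) := by
  refine ⟨fun S _ hS => ?_, fun S _ hS X ι hι => ?_, fun G _ X ι hι c hc _ => ?_⟩
  -- With `S` generating itself, the first claim is an instance of the second.
  · have hι : IsGeneratedBy (id : S → S) := fun T hT _ => eq_top_iff.2 fun s _ => hT s
    exact ⟨GroupImage S, inferInstance, _, inferInstance, inferInstance, _,
      isMcAlisterTriple_compactGraphs hι.groupGen,
      ⟨(closureMonoidEquiv hS hι).trans (closureMonoidEquivPSemigroup _)⟩⟩
  · exact ⟨schutzenbergerClosure hS hι, schutzenbergerClosure_gInvariant hS hι,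
      schutzenbergerClosure_isFinitary hS hι, fun _ => schutzenbergerClosure_eq_iff hS hι,
      ⟨closureMonoidEquiv hS hι, fun s => ⟨(schutzenbergerGraph_eq hι s).symm, rfl⟩⟩,
      isMcAlisterTriple_compactGraphs hι.groupGen,
      (closureMonoidEquiv hS hι).trans (closureMonoidEquivPSemigroup _),
      fun s => ⟨(schutzenbergerGraph_eq hι s).symm, rfl⟩⟩
  · exact ⟨closureMonoid_isEUnitary, isMcAlisterTriple_compactGraphs hι,
      exists_isGLB_compactGraphsOne, closureMonoidEquivPSemigroup _, fun _ => ⟨rfl, rfl⟩⟩
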